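/- **Theorem (Hölder estimate on $\Sigma_0\cup\Sigma_-$).** Let $\Omega\subset\mathbb{R}^d$ be a bounded domain with $\partial\Omega\in C^{1,1}$ and unit outward normal $n_x$ at $x\in\partial\Omega$, let $\alpha_b\in(0,1)$ and $0<\lambda<\Lambda$. Write $z=(t,x,v)\in\mathbb{R}\times\mathbb{R}^d\times\mathbb{R}^d$, let $|\cdot|$ be the Euclidean norm, and set $$\Sigma_-=\{(t,x,v): x\in\partial\Omega,\ n_x\cdot v<0\},\qquad \Sigma_0=\{(t,x,v): x\in\partial\Omega,\ n_x\cdot v=0\},$$ $$Q_r(z_0)=\{(t,x,v):\ t_0-r^2<t\le t_0,\ |x-x_0-(t-t_0)v_0|<r^3,\ |v-v_0|<r\},\qquad G_r(z_0)=\{(t,x,v)\in Q_r(z_0):\ x\in\overline\Omega\}.$$ Then there exist $\alpha\in(0,1)$ depending only on $d,\alpha_b,\lambda,\Lambda,\Omega$, and, for every value of $|z_0|$, a constant $C>0$ depending only on $d,\alpha_b,\lambda,\Lambda,\Omega$ and $|z_0|$, such that the following holds. Let $z_0=(t_0,x_0,v_0)\in\Sigma_0\cup\Sigma_-$. At the interior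 points of $G_2(z_0)$ (those with $x\in\Omega$ and $t<t_0$), let the $d\times d$ real symmetric matrix $A(z)$ and the vector $B(z)\in\mathbb{R}^d$ satisfy $\lambda I_d\le A(z)\le\Lambda I_d$ and $|B(z)|\le\Lambda(1+|v|^2)$. Let $S$ be measurable and essentially bounded on $G_2(z_0)$, and let $f_b$ have finite Hölder norm $$\|f_b\|_{C^{\alpha_b}(Q_2(z_0)\cap\Sigma_-)}=\sup|f_b|+\sup_{z\ne z'}\frac{|f_b(z)-f_b(z')|}{|z-z'|^{\alpha_b}}.$$ Let $f$ be a bounded classical solution of $$\partial_tf+v\cdot\nabla_xf=A:D_v^2f+B\cdot\nabla_vf+S\quad\text{in }G_2(z_0),\qquad f=f_b\ \text{ on }Q_2(z_0)\cap\Sigma_-;$$ that is, $f$ is continuous on $G_2(z_0)$, in its interior $(\partial_t+v\cdot\nabla_x)f$ (the derivative along the transport direction) and $D_v^2f$ exist and are continuous, and the equation holds there pointwise. Then for every $z\in G_1(z_0)$, $$|f(z_0)-f(z)|\le C\,|z_0-z|^\alpha\Big(\|f_b\|_{C^{\alpha_b}(Q_2(z_0)\cap\Sigma_-)}+\|f\|_{L^\infty(G_2(z_0))}+\|S\|_{L^\infty(G_2(z_0))}\Big).$$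 -/

import Mathlib

open MeasureTheory Set
open scoped ENNReal NNReal

noncomputable section

namespace KFP

/-- Euclidean space of dimension `d`. -/
abbrev Vec (d : ℕ) := EuclideanSpace ℝ (Fin d)

/-- Phase space: points `z = (t, x, v)`, that is `z.1 = t`, `z.2.1 = x`, `z.2.2 = v`.
The product type carries the supremum norm, so the Euclidean length is introduced separately
as `phaseNorm`; topology and Lebesgue measure are those of the product. -/
abbrev Phase (d : ℕ) := ℝ × Vec d × Vec d

/-- The Euclidean norm `|z|` of `z = (t, x, v)`. -/
def phaseNorm {d : ℕ} (z : Phase d) : ℝ :=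
  Real.sqrt (z.1 ^ 2 + ‖z.2.1‖ ^ 2 + ‖z.2.2‖ ^ 2)

/-! ### Domains with `C^{1,1}` boundary -/

/-- In the coordinates with vertical direction `e` (a unit vector), the height of `x` above the
graph of `γ`. Only the values of `γ` on the hyperplane orthogonal to `e` enter. -/
def heightAbove {d : ℕ} (e : Vec d) (γ : Vec d → ℝ) (x : Vec d) : ℝ :=
  inner ℝ e x - γ (x - (inner ℝ e x : ℝ) • e)

/-- In the ball `B_r(x₀)`, the set `Ω` is exactly the region lying strictly below the graph, in the
vertical direction `e`, of the `C^{1,1}` function `γ`. -/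
structure IsBoundaryGraph {d : ℕ} (Ω : Set (Vec d)) (x₀ : Vec d) (r : ℝ) (e : Vec d)
    (γ : Vec d → ℝ) : Prop where
  r_pos : 0 < r
  norm_e : ‖e‖ = 1
  contDiff : ContDiff ℝ 1 γ
  lipschitz : ∃ K : ℝ≥0, LipschitzWith K (fderiv ℝ γ)
  mem_iff : ∀ x ∈ Metric.ball x₀ r, x ∈ Ω ↔ heightAbove e γ x < 0

/-- `∂Ω ∈ C^{1,1}`. -/
def HasC11Boundary {d : ℕ} (Ω : Set (Vec d)) : Prop :=
  ∀ x₀ ∈ frontier Ω, ∃ r e γ, IsBoundaryGraph Ω x₀ r e γ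

/-- `n` is the unit outward normal to `∂Ω` at `x ∈ ∂Ω`: the normalized gradient of the height above
a local boundary graph (it does not depend on the graph that is used). -/
def IsOutwardNormal {d : ℕ} (Ω : Set (Vec d)) (x n : Vec d) : Prop :=
  ∃ r e γ, IsBoundaryGraph Ω x r e γ ∧
    n = ‖gradient (heightAbove e γ) x‖⁻¹ • gradient (heightAbove e γ) x

/-- The incoming boundary `Σ₋`: `x ∈ ∂Ω` and `n_x · v < 0`. -/
def incoming {d : ℕ} (Ω : Set (Vec d)) : Set (Phase d) :=
  {z | z.2.1 ∈ frontier Ω ∧ ∃ n, IsOutwardNormal Ω z.2.1 n ∧ inner ℝ n z.2.2 < 0}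

/-- The grazing boundary `Σ₀`: `x ∈ ∂Ω` and `n_x · v = 0`. -/
def grazing {d : ℕ} (Ω : Set (Vec d)) : Set (Phase d) :=
  {z | z.2.1 ∈ frontier Ω ∧ ∃ n, IsOutwardNormal Ω z.2.1 n ∧ inner ℝ n z.2.2 = 0}

/-! ### Kinetic cylinders -/

/-- The kinetic cylinder `Q_r(z₀)`. -/
def cyl {d : ℕ} (r : ℝ) (z₀ : Phase d) : Set (Phase d) :=
  {z | z₀.1 - r ^ 2 < z.1 ∧ z.1 ≤ z₀.1 ∧ ‖z.2.1 - z₀.2.1 - (z.1 - z₀.1) • z₀.2.2‖ < r ^ 3 ∧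
    ‖z.2.2 - z₀.2.2‖ < r}

/-- `G_r(z₀)`, the part of the kinetic cylinder over the closure of `Ω`. -/
def domCyl {d : ℕ} (Ω : Set (Vec d)) (r : ℝ) (z₀ : Phase d) : Set (Phase d) :=
  {z | z ∈ cyl r z₀ ∧ z.2.1 ∈ closure Ω}

/-- The interior of `G_r(z₀)`: the points with `x ∈ Ω`, before the final time of the cylinder. -/
def domCylInterior {d : ℕ} (Ω : Set (Vec d)) (r : ℝ) (z₀ : Phase d) : Set (Phase d) :=
  {z | z ∈ cyl r z₀ ∧ z.1 < z₀.1 ∧ z.2.1 ∈ Ω}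

/-! ### The equation -/

/-- The function `s ↦ f (t + s, x + s v, v)`. -/
def alongTransport {d : ℕ} (f : Phase d → ℝ) (z : Phase d) (s : ℝ) : ℝ :=
  f (z.1 + s, z.2.1 + s • z.2.2, z.2.2)

/-- `(∂_t + v · ∇_x) f` at `z`. -/
def transportDeriv {d : ℕ} (f : Phase d → ℝ) (z : Phase d) : ℝ :=
  deriv (alongTransport f z) 0

/-- The velocity slice `w ↦ f (t, x, w)` through `z = (t, x, v)`. -/
def vSlice {d : ℕ} (f : Phase d → ℝ) (z : Phase d) (w : Vec d) : ℝ :=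
  f (z.1, z.2.1, w)

/-- The gradient `∇_v f` at `z`. -/
def vGrad {d : ℕ} (f : Phase d → ℝ) (z : Phase d) : Vec d :=
  gradient (vSlice f z) z.2.2

/-- The Hessian `D²_v f` at `z`, as a matrix. -/
def vHess {d : ℕ} (f : Phase d → ℝ) (z : Phase d) : Matrix (Fin d) (Fin d) ℝ :=
  fun i j => fderiv ℝ (fderiv ℝ (vSlice f z)) z.2.2
    (EuclideanSpace.single i 1) (EuclideanSpace.single j 1)

/-- The coefficient bounds on the set `U`: `A` is symmetric, `lam I ≤ A ≤ Lam I`,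
and `|B| ≤ Lam (1 + |v|²)`. -/
structure CoeffBounds {d : ℕ} (lam Lam : ℝ) (A : Phase d → Matrix (Fin d) (Fin d) ℝ)
    (B : Phase d → Vec d) (U : Set (Phase d)) : Prop where
  symm : ∀ z ∈ U, (A z).IsSymm
  lower : ∀ z ∈ U, ∀ ξ : Vec d, lam * ‖ξ‖ ^ 2 ≤ ∑ i, ∑ j, A z i j * ξ i * ξ j
  upper : ∀ z ∈ U, ∀ ξ : Vec d, ∑ i, ∑ j, A z i j * ξ i * ξ j ≤ Lam * ‖ξ‖ ^ 2
  drift : ∀ z ∈ U, ‖B z‖ ≤ Lam * (1 + ‖z.2.2‖ ^ 2)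

/-- `f` is a classical solution of `(∂_t + v · ∇_x) f = A : D²_v f + B · ∇_v f + S` in `G_r(z₀)`:
it is continuous on `G_r(z₀)`, up to the boundary of `Ω`; in the interior `(∂_t + v · ∇_x) f` and
`D²_v f` exist and are continuous in `z`, and the equation holds at every point. -/
structure IsClassicalSolution {d : ℕ} (Ω : Set (Vec d)) (r : ℝ) (z₀ : Phase d)
    (A : Phase d → Matrix (Fin d) (Fin d) ℝ) (B : Phase d → Vec d) (S f : Phase d → ℝ) :
    Prop where
  continuousOn : ContinuousOn f (domCyl Ω r z₀)
  transport_differentiable :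
    ∀ z ∈ domCylInterior Ω r z₀, DifferentiableAt ℝ (alongTransport f z) 0
  transport_continuousOn : ContinuousOn (transportDeriv f) (domCylInterior Ω r z₀)
  velocity_contDiffAt : ∀ z ∈ domCylInterior Ω r z₀, ContDiffAt ℝ 2 (vSlice f z) z.2.2
  hess_continuousOn : ContinuousOn (vHess f) (domCylInterior Ω r z₀)
  equation : ∀ z ∈ domCylInterior Ω r z₀,
    transportDeriv f z =
      (∑ i, ∑ j, A z i j * vHess f z i j) + inner ℝ (B z) (vGrad f z) + S z

/-! ### Norms -/

/-- The Hölder norm `‖g‖_{C^β(K)} = sup_K |g| + sup_{z ≠ z' ∈ K} |g(z) - g(z')| / |z - z'|^β`,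
with respect to the Euclidean distance, as an extended nonnegative number. -/
def holderNorm {d : ℕ} (β : ℝ) (g : Phase d → ℝ) (K : Set (Phase d)) : ℝ≥0∞ :=
  (⨆ z ∈ K, ENNReal.ofReal |g z|) +
    ⨆ z ∈ K, ⨆ z' ∈ K, ⨆ _ : z ≠ z', ENNReal.ofReal (|g z - g z'| / phaseNorm (z - z') ^ β)

/-- The norm `‖g‖_{L^∞(K)}` (essential supremum for Lebesgue measure). -/
def supNorm {d : ℕ} (g : Phase d → ℝ) (K : Set (Phase d)) : ℝ≥0∞ :=
  eLpNorm g ∞ (volume.restrict K)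

end KFP

end

noncomputable section

namespace KFP

/-! ### Boundary graphs: gradient of the height, independence of the chart, uniform constants -/

section Geometry

variable {d : ℕ} {Ω : Set (Vec d)} {x₀ e : Vec d} {r : ℝ} {γ : Vec d → ℝ}

/-- The projection `x ↦ x - ⟪e, x⟫ e`. -/
def dropAlong (e : Vec d) : Vec d →L[ℝ] Vec d :=
  ContinuousLinearMap.id ℝ (Vec d) - (innerSL ℝ e).smulRight e

lemma dropAlong_apply (e x : Vec d) : dropAlong e x = x - (inner ℝ e x : ℝ) • e := by
  simp [dropAlong]

lemma IsBoundaryGraph.hasFDerivAt (h : IsBoundaryGraph Ω x₀ r e γ) (x : Vec d) :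
    HasFDerivAt (heightAbove e γ)
      (innerSL ℝ e - (fderiv ℝ γ (dropAlong e x)).comp (dropAlong e)) x := by
  have h1 : HasFDerivAt γ (fderiv ℝ γ (dropAlong e x)) (dropAlong e x) :=
    ((h.contDiff.differentiable (by norm_num)) _).hasFDerivAt
  have h2 := (innerSL ℝ e).hasFDerivAt (x := x)
  have h3 := h2.sub (h1.comp x (dropAlong e).hasFDerivAt)
  have h4 : heightAbove e γ = ⇑(innerSL ℝ e) - γ ∘ ⇑(dropAlong e) := by
    funext y
    simp [heightAbove, dropAlong_apply]
  rw [h4]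
  exact h3

lemma IsBoundaryGraph.differentiable (h : IsBoundaryGraph Ω x₀ r e γ) :
    Differentiable ℝ (heightAbove e γ) := fun x => (h.hasFDerivAt x).differentiableAt

lemma IsBoundaryGraph.hasGradientAt (h : IsBoundaryGraph Ω x₀ r e γ) (x : Vec d) :
    HasGradientAt (heightAbove e γ) (gradient (heightAbove e γ) x) x :=
  (h.differentiable x).hasGradientAt

lemma inner_gradient {g : Vec d → ℝ} (x u : Vec d) :
    inner ℝ (gradient g x) u = fderiv ℝ g x u := by
  simp [gradient]

/-- The graph function sees only the projection orthogonal to `e`, so moving along `e` changes the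
height at unit rate. In particular the gradient never vanishes and can be normalized. -/
lemma IsBoundaryGraph.inner_e_gradient (h : IsBoundaryGraph Ω x₀ r e γ) (x : Vec d) :
    inner ℝ (gradient (heightAbove e γ) x) e = (1 : ℝ) := by
  rw [inner_gradient, (h.hasFDerivAt x).fderiv]
  have : dropAlong e e = 0 := by
    rw [dropAlong_apply, real_inner_self_eq_norm_sq, h.norm_e]; simp
  simp [this, h.norm_e]

lemma IsBoundaryGraph.one_le_norm_gradient (h : IsBoundaryGraph Ω x₀ r e γ) (x : Vec d) :
    1 ≤ ‖gradient (heightAbove e γ) x‖ := by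
  have := real_inner_le_norm (gradient (heightAbove e γ) x) e
  rwa [h.inner_e_gradient, h.norm_e, mul_one] at this

lemma norm_gradient_sub {g : Vec d → ℝ} (x y : Vec d) :
    ‖gradient g x - gradient g y‖ = ‖fderiv ℝ g x - fderiv ℝ g y‖ := by
  rw [gradient, gradient, ← map_sub, LinearIsometryEquiv.norm_map]

lemma IsBoundaryGraph.exists_lipschitz_gradient (h : IsBoundaryGraph Ω x₀ r e γ) :
    ∃ K : ℝ≥0, LipschitzWith K (gradient (heightAbove e γ)) := by
  obtain ⟨K, hK⟩ := h.lipschitz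
  refine ⟨K * ‖dropAlong e‖₊ * ‖dropAlong e‖₊, LipschitzWith.of_dist_le_mul fun x y => ?_⟩
  rw [dist_eq_norm, norm_gradient_sub, (h.hasFDerivAt x).fderiv, (h.hasFDerivAt y).fderiv,
    sub_sub_sub_cancel_left, ← ContinuousLinearMap.sub_comp]
  refine (ContinuousLinearMap.opNorm_comp_le _ _).trans ?_
  have h1 := hK.dist_le_mul (dropAlong e y) (dropAlong e x)
  rw [dist_eq_norm, dist_eq_norm, ← map_sub] at h1
  have h2 := (dropAlong e).le_opNorm (y - x)
  rw [norm_sub_rev y x] at h2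
  rw [dist_eq_norm]
  push_cast
  calc _ ≤ (K * (‖dropAlong e‖ * ‖x - y‖)) * ‖dropAlong e‖ := by gcongr; exact h1.trans (by gcongr)
    _ = _ := by ring

/-- Mean value inequality on the ball of radius `‖y - x‖`, where the derivative varies by at most `K
* ‖y - x‖`; this costs a factor two against the sharp constant. -/
lemma IsBoundaryGraph.abs_taylor_le (h : IsBoundaryGraph Ω x₀ r e γ) {K : ℝ≥0}
    (hK : LipschitzWith K (gradient (heightAbove e γ))) (x y : Vec d) :
    |heightAbove e γ y - heightAbove e γ x - inner ℝ (gradient (heightAbove e γ) x) (y - x)|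
      ≤ K * ‖y - x‖ ^ 2 := by
  have key := (convex_closedBall x ‖y - x‖).norm_image_sub_le_of_norm_fderiv_le'
    (f := heightAbove e γ) (φ := fderiv ℝ (heightAbove e γ) x) (C := K * ‖y - x‖) (x := x) (y := y)
    (fun z _ => h.differentiable z) (fun z hz => by
      rw [← norm_gradient_sub, ← dist_eq_norm]
      refine (hK.dist_le_mul _ _).trans ?_
      gcongr
      simpa [dist_eq_norm] using hz) (by simp) (by simp [dist_eq_norm])
  rw [inner_gradient, ← Real.norm_eq_abs]
  exact key.trans_eq (by ring)

lemma IsBoundaryGraph.recenter (h : IsBoundaryGraph Ω x₀ r e γ) {x : Vec d} {s : ℝ}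
    (hs : 0 < s) (hx : dist x x₀ + s ≤ r) : IsBoundaryGraph Ω x s e γ :=
  ⟨hs, h.norm_e, h.contDiff, h.lipschitz, fun y hy => h.mem_iff y (by
    rw [Metric.mem_ball] at hy ⊢
    linarith [dist_triangle y x x₀])⟩

lemma IsBoundaryGraph.continuous (h : IsBoundaryGraph Ω x₀ r e γ) :
    Continuous (heightAbove e γ) := h.differentiable.continuous

lemma IsBoundaryGraph.nonpos_of_mem_closure (h : IsBoundaryGraph Ω x₀ r e γ) {x : Vec d}
    (hx : x ∈ Metric.ball x₀ r) (hc : x ∈ closure Ω) : heightAbove e γ x ≤ 0 := by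
  by_contra! hpos
  have hU : {y | 0 < heightAbove e γ y} ∩ Metric.ball x₀ r ∈ nhds x :=
    ((isOpen_lt continuous_const h.continuous).inter Metric.isOpen_ball).mem_nhds ⟨hpos, hx⟩
  obtain ⟨y, ⟨hy1, hy2⟩, hy3⟩ := mem_closure_iff_nhds.1 hc _ hU
  have := (h.mem_iff y hy2).1 hy3
  exact absurd hy1 (not_lt.2 this.le)

lemma IsBoundaryGraph.eq_zero_of_mem_frontier (h : IsBoundaryGraph Ω x₀ r e γ) (hΩ : IsOpen Ω)
    {x : Vec d} (hx : x ∈ Metric.ball x₀ r) (hf : x ∈ frontier Ω) : heightAbove e γ x = 0 := by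
  refine le_antisymm (h.nonpos_of_mem_closure hx (frontier_subset_closure hf)) ?_
  by_contra! hlt
  rw [hΩ.frontier_eq] at hf
  exact hf.2 ((h.mem_iff x hx).2 hlt)

/-- The direction of the gradient of the height does not depend on the graph. -/
lemma IsBoundaryGraph.inner_gradient_nonpos {e' : Vec d} {r' : ℝ} {γ' : Vec d → ℝ}
    (h : IsBoundaryGraph Ω x₀ r e γ) (h' : IsBoundaryGraph Ω x₀ r' e' γ') (hΩ : IsOpen Ω)
    (hf : x₀ ∈ frontier Ω) {u : Vec d}
    (hu : inner ℝ (gradient (heightAbove e γ) x₀) u ≤ (0 : ℝ)) :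
    inner ℝ (gradient (heightAbove e' γ') x₀) u ≤ (0 : ℝ) := by
  have line : ∀ (g : Vec d → ℝ) (w : Vec d), Differentiable ℝ g →
      HasDerivAt (fun s : ℝ => g (x₀ + s • w)) (inner ℝ (gradient g x₀) w) 0 := by
    intro g w hg
    have h1 : HasFDerivAt g (fderiv ℝ g x₀) (x₀ + (0 : ℝ) • w) := by
      simpa using (hg x₀).hasFDerivAt
    have h2 : HasDerivAt (fun s : ℝ => x₀ + s • w) w 0 := by
      simpa using ((hasDerivAt_id (0 : ℝ)).smul_const w).const_add x₀
    rw [inner_gradient]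
    exact h1.comp_hasDerivAt (0 : ℝ) h2
  -- If one height strictly decreased and the other strictly increased along `w`, the points `x₀ + s
  -- w` would for small `s > 0` be both in and outside `Ω`.
  have strict : ∀ w : Vec d, inner ℝ (gradient (heightAbove e γ) x₀) w < (0 : ℝ) →
      inner ℝ (gradient (heightAbove e' γ') x₀) w ≤ (0 : ℝ) := by
    intro w hw
    by_contra! hpos
    have z1 := h.eq_zero_of_mem_frontier hΩ (Metric.mem_ball_self h.r_pos) hf
    have z2 := h'.eq_zero_of_mem_frontier hΩ (Metric.mem_ball_self h'.r_pos) hf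
    have ev : ∀ (g : Vec d → ℝ), Differentiable ℝ g → g x₀ = 0 →
        0 < inner ℝ (gradient g x₀) w → ∀ᶠ s in nhdsWithin (0 : ℝ) (Ioi 0), 0 < g (x₀ + s • w) := by
      intro g hg h0 hd
      have := (line g w hg).hasDerivWithinAt (s := Ioi 0)
      rw [hasDerivWithinAt_iff_tendsto_slope' (by simp)] at this
      filter_upwards [this.eventually (lt_mem_nhds hd), self_mem_nhdsWithin] with s hs hs0
      rw [slope_def_field] at hs
      simp only [zero_smul, add_zero, h0, sub_zero] at hs
      have hs0 : (0 : ℝ) < s := hs0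
      exact (div_pos_iff_of_pos_right hs0).1 hs
    have e1 := ev (fun y => -heightAbove e γ y) h.differentiable.neg (by simp [z1]) (by
      rw [inner_gradient, fderiv_fun_neg, neg_apply, ← inner_gradient]
      linarith)
    have e2 := ev _ h'.differentiable z2 hpos
    have hc : Filter.Tendsto (fun s : ℝ => x₀ + s • w) (nhdsWithin 0 (Ioi 0)) (nhds x₀) := by
      have : Continuous fun s : ℝ => x₀ + s • w := by fun_prop
      have := (this.tendsto 0).mono_left (nhdsWithin_le_nhds (s := Ioi 0))
      simpa using this
    obtain ⟨s, s1, s2, s3, s4⟩ := (e1.and (e2.and ((hc.eventually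
      (Metric.ball_mem_nhds x₀ h.r_pos)).and (hc.eventually
      (Metric.ball_mem_nhds x₀ h'.r_pos))))).exists
    have := (h'.mem_iff _ s4).1 ((h.mem_iff _ s3).2 (by simpa using s1))
    exact absurd s2 (not_lt.2 this.le)
  set g := gradient (heightAbove e γ) x₀
  have hgn : 0 < ‖g‖ := lt_of_lt_of_le one_pos (h.one_le_norm_gradient x₀)
  -- The non-strict case is a limit of the strict one: subtracting `s • g` makes the first inner
  -- product negative.
  have hlim : Filter.Tendsto (fun s : ℝ => (inner ℝ (gradient (heightAbove e' γ') x₀)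
      (u - s • g) : ℝ)) (nhdsWithin 0 (Ioi 0))
      (nhds (inner ℝ (gradient (heightAbove e' γ') x₀) u)) := by
    have : Continuous fun s : ℝ => (inner ℝ (gradient (heightAbove e' γ') x₀) (u - s • g) : ℝ) := by
      fun_prop
    have := (this.tendsto 0).mono_left (nhdsWithin_le_nhds (s := Ioi 0))
    simpa using this
  refine le_of_tendsto hlim ?_
  filter_upwards [self_mem_nhdsWithin] with s hs
  have hs : (0 : ℝ) < s := hs
  apply strict
  rw [inner_sub_right, inner_smul_right, real_inner_self_eq_norm_sq]
  have : 0 < s * ‖g‖ ^ 2 := by positivity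
  linarith

/-- Boundary graphs with uniform constants. -/
lemma HasC11Boundary.exists_uniform (hb : HasC11Boundary Ω) (hΩ : Bornology.IsBounded Ω) :
    ∃ R > 0, ∃ L : ℝ, 0 ≤ L ∧ ∃ K : ℝ≥0, ∀ x₀ ∈ frontier Ω, ∃ e γ, IsBoundaryGraph Ω x₀ R e γ ∧
      LipschitzWith K (gradient (heightAbove e γ)) ∧ ‖gradient (heightAbove e γ) x₀‖ ≤ L := by
  have hcomp : IsCompact (frontier Ω) :=
    Metric.isCompact_of_isClosed_isBounded isClosed_frontier
      (hΩ.closure.subset frontier_subset_closure)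
  let P : Set (Vec d) → Prop := fun s => ∃ R > 0, ∃ L : ℝ, 0 ≤ L ∧ ∃ K : ℝ≥0, ∀ x₀ ∈ s, ∃ e γ,
    IsBoundaryGraph Ω x₀ R e γ ∧ LipschitzWith K (gradient (heightAbove e γ)) ∧
      ‖gradient (heightAbove e γ) x₀‖ ≤ L
  have hP : P (frontier Ω) := by
    refine hcomp.induction_on (p := P) ⟨1, one_pos, 0, le_rfl, 0, by simp⟩ ?_ ?_ ?_
    · rintro s t hst ⟨R, hR, L, hL, K, h⟩
      exact ⟨R, hR, L, hL, K, fun x hx => h x (hst hx)⟩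
    · rintro s t ⟨R, hR, L, hL, K, h⟩ ⟨R', hR', L', hL', K', h'⟩
      refine ⟨min R R', lt_min hR hR', max L L', le_max_of_le_left hL, max K K', ?_⟩
      rintro x (hx | hx)
      · obtain ⟨e, γ, h1, h2, h3⟩ := h x hx
        exact ⟨e, γ, h1.recenter (lt_min hR hR') (by simp), h2.weaken (le_max_left _ _),
          h3.trans (le_max_left _ _)⟩
      · obtain ⟨e, γ, h1, h2, h3⟩ := h' x hx
        exact ⟨e, γ, h1.recenter (lt_min hR hR') (by simp), h2.weaken (le_max_right _ _),
          h3.trans (le_max_right _ _)⟩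
    -- Membership is described on a whole ball, so one graph, recentred with half the radius, serves
    -- all boundary points near `x`.
    · intro x hx
      obtain ⟨r, e, γ, h⟩ := hb x hx
      obtain ⟨K, hK⟩ := h.exists_lipschitz_gradient
      have hr := h.r_pos
      refine ⟨Metric.ball x (r / 2), mem_nhdsWithin_of_mem_nhds (Metric.ball_mem_nhds x (by linarith)),
        r / 2, by linarith, ‖gradient (heightAbove e γ) x‖ + K * (r / 2), by positivity, K,
        fun y hy => ⟨e, γ, h.recenter (by linarith) ?_, hK, ?_⟩⟩
      · have := Metric.mem_ball.1 hy; linarith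
      · have h1 := hK.dist_le_mul y x
        rw [dist_eq_norm] at h1
        have h2 : (K : ℝ) * dist y x ≤ K * (r / 2) := by
          gcongr; exact (Metric.mem_ball.1 hy).le
        have h3 := norm_sub_norm_le (gradient (heightAbove e γ) y) (gradient (heightAbove e γ) x)
        linarith
  exact hP

end Geometry

/-! ### Pointwise consequences of the equation at interior points -/

section Touching

variable {d : ℕ} {Ω : Set (Vec d)} {z₀ : Phase d} {r : ℝ}

lemma domCylInterior_eq (Ω : Set (Vec d)) (r : ℝ) (z₀ : Phase d) :
    domCylInterior Ω r z₀ = {z | z₀.1 - r ^ 2 < z.1 ∧ z.1 < z₀.1 ∧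
      ‖z.2.1 - z₀.2.1 - (z.1 - z₀.1) • z₀.2.2‖ < r ^ 3 ∧ ‖z.2.2 - z₀.2.2‖ < r ∧ z.2.1 ∈ Ω} := by
  ext z
  simp only [domCylInterior, cyl, Set.mem_ofPred_eq]
  constructor
  · rintro ⟨⟨h1, h2, h3, h4⟩, h5, h6⟩
    exact ⟨h1, h5, h3, h4, h6⟩
  · rintro ⟨h1, h5, h3, h4, h6⟩
    exact ⟨⟨h1, h5.le, h3, h4⟩, h5, h6⟩

lemma isOpen_domCylInterior (hΩ : IsOpen Ω) : IsOpen (domCylInterior Ω r z₀) := by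
  rw [domCylInterior_eq]
  have h1 : IsOpen {z : Phase d | z₀.1 - r ^ 2 < z.1} := isOpen_lt (by fun_prop) (by fun_prop)
  have h2 : IsOpen {z : Phase d | z.1 < z₀.1} := isOpen_lt (by fun_prop) (by fun_prop)
  have h3 : IsOpen {z : Phase d | ‖z.2.1 - z₀.2.1 - (z.1 - z₀.1) • z₀.2.2‖ < r ^ 3} :=
    isOpen_lt (by fun_prop) (by fun_prop)
  have h4 : IsOpen {z : Phase d | ‖z.2.2 - z₀.2.2‖ < r} := isOpen_lt (by fun_prop) (by fun_prop)
  have h5 : IsOpen {z : Phase d | z.2.1 ∈ Ω} := hΩ.preimage (by fun_prop)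
  exact h1.inter (h2.inter (h3.inter (h4.inter h5)))

/-- The shift of `z` by `s ξ` in the velocity variable. -/
def vShift (z : Phase d) (s : ℝ) (ξ : Vec d) : Phase d := (z.1, z.2.1, z.2.2 + s • ξ)

/-- The quadratic form of the velocity Hessian. -/
def hessForm (f : Phase d → ℝ) (z : Phase d) (ξ : Vec d) : ℝ :=
  fderiv ℝ (fderiv ℝ (vSlice f z)) z.2.2 ξ ξ

lemma hessForm_eq_sum (f : Phase d → ℝ) (z : Phase d) (ξ : Vec d) :
    hessForm f z ξ = ∑ i, ∑ j, vHess f z i j * ξ i * ξ j := by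
  have hξ : ξ = ∑ i, ξ i • EuclideanSpace.single i (1 : ℝ) := by
    ext j
    simp [Pi.single_apply]
  conv_lhs => rw [hessForm, hξ]
  simp only [map_sum, map_smul, sum_apply, smul_apply, smul_eq_mul, Finset.mul_sum, vHess]
  rw [Finset.sum_comm]
  refine Finset.sum_congr rfl fun i _ => Finset.sum_congr rfl fun j _ => ?_
  ring

variable {A : Phase d → Matrix (Fin d) (Fin d) ℝ} {B : Phase d → Vec d} {S f : Phase d → ℝ}

lemma IsClassicalSolution.hasDerivAt_line (hf : IsClassicalSolution Ω r z₀ A B S f) {z : Phase d}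
    (ξ : Vec d) {s : ℝ} (hz : vShift z s ξ ∈ domCylInterior Ω r z₀) :
    HasDerivAt (fun τ => f (vShift z τ ξ)) (fderiv ℝ (vSlice f z) (z.2.2 + s • ξ) ξ) s := by
  have h1 : DifferentiableAt ℝ (vSlice f z) (z.2.2 + s • ξ) :=
    (hf.velocity_contDiffAt _ hz).differentiableAt (by norm_num)
  have h2 : HasDerivAt (fun τ : ℝ => z.2.2 + τ • ξ) ξ s := by
    simpa using ((hasDerivAt_id s).smul_const ξ).const_add z.2.2
  exact h1.hasFDerivAt.comp_hasDerivAt s h2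

lemma IsClassicalSolution.hasDerivAt_line_fderiv (hf : IsClassicalSolution Ω r z₀ A B S f)
    {z : Phase d} (ξ : Vec d) {s : ℝ} (hz : vShift z s ξ ∈ domCylInterior Ω r z₀) :
    HasDerivAt (fun τ : ℝ => fderiv ℝ (vSlice f z) (z.2.2 + τ • ξ) ξ)
      (hessForm f (vShift z s ξ) ξ) s := by
  have h0 : ContDiffAt ℝ 2 (vSlice f z) (z.2.2 + s • ξ) := hf.velocity_contDiffAt _ hz
  have h1 : DifferentiableAt ℝ (fderiv ℝ (vSlice f z)) (z.2.2 + s • ξ) :=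
    (h0.fderiv_right (m := 1) (by norm_num)).differentiableAt (by norm_num)
  have h2 : HasDerivAt (fun τ : ℝ => z.2.2 + τ • ξ) ξ s := by
    simpa using ((hasDerivAt_id s).smul_const ξ).const_add z.2.2
  have h3 := h1.hasFDerivAt.comp_hasDerivAt s h2
  exact h3.clm_apply (hasDerivAt_const s ξ) |>.congr_deriv (by simp [hessForm, vShift]; rfl)

lemma continuous_vShift (ξ : Vec d) : Continuous fun p : Phase d × ℝ => vShift p.1 p.2 ξ := by
  unfold vShift
  fun_prop

lemma IsClassicalSolution.continuousAt_hess (hf : IsClassicalSolution Ω r z₀ A B S f)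
    (hΩ : IsOpen Ω) {z : Phase d} (hz : z ∈ domCylInterior Ω r z₀) : ContinuousAt (vHess f) z :=
  hf.hess_continuousOn.continuousAt ((isOpen_domCylInterior hΩ).mem_nhds hz)

lemma IsClassicalSolution.continuousAt_hess_apply (hf : IsClassicalSolution Ω r z₀ A B S f)
    (hΩ : IsOpen Ω) {z : Phase d} (hz : z ∈ domCylInterior Ω r z₀) (i j : Fin d) :
    ContinuousAt (fun z => vHess f z i j) z :=
  continuousAt_pi.1 (continuousAt_pi.1 (hf.continuousAt_hess hΩ hz) i) j

lemma IsClassicalSolution.continuousAt_hessForm (hf : IsClassicalSolution Ω r z₀ A B S f)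
    (hΩ : IsOpen Ω) {z : Phase d} (hz : z ∈ domCylInterior Ω r z₀) (ξ : Vec d) :
    ContinuousAt (fun z => hessForm f z ξ) z := by
  simp only [hessForm_eq_sum]
  have h : ∀ i j, ContinuousAt (fun z => vHess f z i j) z := fun i j =>
    hf.continuousAt_hess_apply hΩ hz i j
  refine tendsto_finsetSum _ fun i _ => tendsto_finsetSum _ fun j _ => ?_
  exact (((h i j).mul continuousAt_const).mul continuousAt_const)

lemma IsClassicalSolution.continuousAt (hf : IsClassicalSolution Ω r z₀ A B S f)
    (hΩ : IsOpen Ω) {z : Phase d} (hz : z ∈ domCylInterior Ω r z₀) : ContinuousAt f z := by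
  refine hf.continuousOn.continuousAt (Filter.mem_of_superset
    ((isOpen_domCylInterior hΩ).mem_nhds hz) ?_)
  exact fun w hw => ⟨hw.1, subset_closure hw.2.2⟩

/-- Velocity derivatives of a classical solution are continuous: the difference quotients converge
locally uniformly, because the velocity Hessian is locally bounded. -/
lemma IsClassicalSolution.continuousAt_fderiv (hf : IsClassicalSolution Ω r z₀ A B S f)
    (hΩ : IsOpen Ω) {z : Phase d} (hz : z ∈ domCylInterior Ω r z₀) (ξ : Vec d) :
    ContinuousAt (fun z => fderiv ℝ (vSlice f z) z.2.2 ξ) z := by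
  -- `C` bounds the second derivative along `ξ` near `z`, so a difference quotient of step `s` is
  -- within `C * s` of the derivative.
  set C : ℝ := |hessForm f z ξ| + 1 with hC
  have hCpos : 0 < C := by positivity
  have hN : {w | w ∈ domCylInterior Ω r z₀ ∧ |hessForm f w ξ| < C} ∈ nhds z :=
    Filter.inter_mem ((isOpen_domCylInterior hΩ).mem_nhds hz)
      ((hf.continuousAt_hessForm hΩ hz ξ).abs.eventually (gt_mem_nhds (lt_add_one _)))
  have hpre : Filter.Tendsto (fun p : Phase d × ℝ => vShift p.1 p.2 ξ) (nhds z ×ˢ nhds 0)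
      (nhds z) := by
    have := (continuous_vShift ξ).tendsto (z, (0 : ℝ))
    rw [nhds_prod_eq] at this
    simpa [vShift] using this
  obtain ⟨V, hV, W, hW, hVW⟩ := Filter.mem_prod_iff.1 (hpre hN)
  obtain ⟨s₀, hs₀, hsW⟩ := Metric.mem_nhds_iff.1 hW
  have good : ∀ w ∈ V, ∀ s ∈ Ico (0 : ℝ) s₀, vShift w s ξ ∈ domCylInterior Ω r z₀ ∧
      |hessForm f (vShift w s ξ) ξ| < C := fun w hw s hs => by
    refine hVW (mk_mem_prod hw (hsW ?_))
    rw [Metric.mem_ball, Real.dist_eq, sub_zero, abs_of_nonneg hs.1]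
    exact hs.2
  refine continuousAt_of_locally_uniform_approx_of_continuousAt fun u hu => ?_
  obtain ⟨ε, hε, hεu⟩ := Metric.mem_uniformity_dist.1 hu
  set s : ℝ := min (s₀ / 2) (ε / (2 * C)) with hs
  have hspos : 0 < s := by positivity
  have hss₀ : s < s₀ := (min_le_left _ _).trans_lt (by linarith)
  refine ⟨V, hV, fun w => (f (vShift w s ξ) - f (vShift w 0 ξ)) / s, ?_, fun w hw => hεu ?_⟩
  · have hcont : ∀ τ ∈ Ico (0 : ℝ) s₀, ContinuousAt (fun w => f (vShift w τ ξ)) z := by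
      intro τ hτ
      have h1 : ContinuousAt (fun w : Phase d => vShift w τ ξ) z := by
        unfold vShift; fun_prop
      exact (hf.continuousAt hΩ (good z (mem_of_mem_nhds hV) τ hτ).1).comp (f := fun w => vShift w τ ξ) h1
    exact ((hcont s ⟨hspos.le, hss₀⟩).sub (hcont 0 ⟨le_rfl, hs₀⟩)).div_const s
  · have hd : ∀ τ ∈ Icc (0 : ℝ) s, HasDerivAt (fun τ => f (vShift w τ ξ))
        (fderiv ℝ (vSlice f w) (w.2.2 + τ • ξ) ξ) τ := fun τ hτ =>
      hf.hasDerivAt_line ξ (good w hw τ ⟨hτ.1, hτ.2.trans_lt hss₀⟩).1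
    have hd2 : ∀ τ ∈ Icc (0 : ℝ) s, HasDerivAt (fun τ : ℝ => fderiv ℝ (vSlice f w) (w.2.2 + τ • ξ) ξ)
        (hessForm f (vShift w τ ξ) ξ) τ := fun τ hτ =>
      hf.hasDerivAt_line_fderiv ξ (good w hw τ ⟨hτ.1, hτ.2.trans_lt hss₀⟩).1
    obtain ⟨a, ha, hae⟩ := exists_hasDerivAt_eq_slope (fun τ => f (vShift w τ ξ)) _ hspos
      (fun τ hτ => (hd τ hτ).continuousAt.continuousWithinAt)
      (fun τ hτ => hd τ (Ioo_subset_Icc_self hτ))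
    obtain ⟨b, hb, hbe⟩ := exists_hasDerivAt_eq_slope
      (fun τ : ℝ => fderiv ℝ (vSlice f w) (w.2.2 + τ • ξ) ξ) _ ha.1
      (fun τ hτ => (hd2 τ ⟨hτ.1, hτ.2.trans ha.2.le⟩).continuousAt.continuousWithinAt)
      (fun τ hτ => hd2 τ ⟨hτ.1.le, hτ.2.le.trans ha.2.le⟩)
    have hH := (good w hw b ⟨hb.1.le, hb.2.trans (ha.2.trans hss₀)⟩).2
    simp only [sub_zero] at hae hbe
    beta_reduce
    rw [← hae, dist_comm, Real.dist_eq]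
    rw [eq_div_iff ha.1.ne'] at hbe
    simp only [zero_smul, add_zero] at hbe
    rw [← hbe, abs_mul, abs_of_pos ha.1]
    calc _ ≤ C * s := mul_le_mul hH.le ha.2.le ha.1.le hCpos.le
      _ ≤ C * (ε / (2 * C)) := by gcongr; exact min_le_right _ _
      _ = ε / 2 := by field_simp
      _ < ε := by linarith

lemma vGrad_apply (f : Phase d → ℝ) (z : Phase d) (i : Fin d) :
    vGrad f z i = fderiv ℝ (vSlice f z) z.2.2 (EuclideanSpace.single i 1) := by
  rw [← inner_gradient, vGrad, EuclideanSpace.inner_single_right]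
  simp

lemma IsClassicalSolution.continuousAt_vGrad (hf : IsClassicalSolution Ω r z₀ A B S f)
    (hΩ : IsOpen Ω) {z : Phase d} (hz : z ∈ domCylInterior Ω r z₀) : ContinuousAt (vGrad f) z := by
  have h1 : ContinuousAt (fun z => (vGrad f z).ofLp) z := by
    refine continuousAt_pi.2 fun i => ?_
    simp only [vGrad_apply]
    exact hf.continuousAt_fderiv hΩ hz _
  exact (PiLp.continuous_toLp 2 (fun _ : Fin d => ℝ)).continuousAt.comp h1

/-- Bounds on a pair of coefficients at one point. -/
structure PointBounds (lam Lam b : ℝ) (A : Matrix (Fin d) (Fin d) ℝ) (B : Vec d) : Prop where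
  symm : A.IsSymm
  lower : ∀ ξ : Vec d, lam * ‖ξ‖ ^ 2 ≤ ∑ i, ∑ j, A i j * ξ i * ξ j
  upper : ∀ ξ : Vec d, ∑ i, ∑ j, A i j * ξ i * ξ j ≤ Lam * ‖ξ‖ ^ 2
  drift : ‖B‖ ≤ b

lemma PointBounds.diag_mem {lam Lam b : ℝ} {A : Matrix (Fin d) (Fin d) ℝ} {B : Vec d}
    (h : PointBounds lam Lam b A B) (i : Fin d) : lam ≤ A i i ∧ A i i ≤ Lam := by
  have h1 := h.lower (EuclideanSpace.single i 1)
  have h2 := h.upper (EuclideanSpace.single i 1)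
  simpa [PiLp.single_apply] using And.intro h1 h2

/-- Polarization: the form is tested on `e_i + e_j` and `e_i - e_j`, and the diagonal entries are
nonnegative. -/
lemma PointBounds.abs_apply_le {lam Lam b : ℝ} {A : Matrix (Fin d) (Fin d) ℝ} {B : Vec d}
    (h : PointBounds lam Lam b A B) (hlam : 0 < lam) (i j : Fin d) : |A i j| ≤ Lam := by
  obtain ⟨hi, hi'⟩ := h.diag_mem i
  obtain ⟨hj, hj'⟩ := h.diag_mem j
  rcases eq_or_ne i j with rfl | hij
  · rw [abs_of_nonneg (by linarith)]; exact hi'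
  have hs : A j i = A i j := h.symm.apply i j
  have form : ∀ s : ℝ, (∑ k, ∑ l, A k l *
      (EuclideanSpace.single i 1 + s • EuclideanSpace.single j 1 : Vec d) k *
      (EuclideanSpace.single i 1 + s • EuclideanSpace.single j 1 : Vec d) l)
      = A i i + 2 * s * A i j + s ^ 2 * A j j := by
    intro s
    simp [PiLp.single_apply, mul_add, add_mul, Finset.sum_add_distrib, hs]
    ring
  have nrm : ∀ s : ℝ, ‖(EuclideanSpace.single i 1 + s • EuclideanSpace.single j 1 : Vec d)‖ ^ 2
      = 1 + s ^ 2 := by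
    intro s
    rw [norm_add_sq_real, inner_smul_right, EuclideanSpace.inner_single_left]
    simp [norm_smul, hij]
  have u1 := h.upper (EuclideanSpace.single i 1 + (1 : ℝ) • EuclideanSpace.single j 1)
  have u2 := h.upper (EuclideanSpace.single i 1 + (-1 : ℝ) • EuclideanSpace.single j 1)
  rw [form, nrm] at u1 u2
  rw [abs_le]
  constructor <;> linarith

lemma isOpenPosMeasure_phase (d : ℕ) : (volume : Measure (Phase d)).IsOpenPosMeasure := by
  have : (volume : Measure (Vec d × Vec d)).IsOpenPosMeasure := inferInstance
  exact Measure.prod.instIsOpenPosMeasure (μ := (volume : Measure ℝ))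
    (ν := (volume : Measure (Vec d × Vec d)))

/-- If the source is only bounded almost everywhere, the equation still yields at every interior
point an inequality with admissible coefficients. -/
lemma IsClassicalSolution.exists_coeff (hf : IsClassicalSolution Ω r z₀ A B S f) (hΩ : IsOpen Ω)
    {lam Lam σ : ℝ} (hlam : 0 < lam) (hLam : lam < Lam)
    (hc : CoeffBounds lam Lam A B (domCylInterior Ω r z₀))
    (hS : ∀ᵐ z ∂volume, z ∈ domCylInterior Ω r z₀ → S z ≤ σ) {z : Phase d}
    (hz : z ∈ domCylInterior Ω r z₀) {κ : ℝ} (hκ : 0 < κ) :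
    ∃ A' B', PointBounds lam Lam (Lam * (1 + ‖z.2.2‖ ^ 2) + κ) A' B' ∧
      transportDeriv f z ≤
        (∑ i, ∑ j, A' i j * vHess f z i j) + inner ℝ B' (vGrad f z) + σ + κ := by
  have hopen := (isOpen_domCylInterior (r := r) (z₀ := z₀) hΩ).mem_nhds hz
  -- `E w` bounds the total cost of keeping the coefficients of `w` while taking the derivatives of
  -- `f` at `z`; its last term pays for the velocity in the drift bound. The coefficients themselves
  -- need not be continuous.
  let E : Phase d → ℝ := fun w => |transportDeriv f w - transportDeriv f z| +
    (∑ i, ∑ j, Lam * |vHess f w i j - vHess f z i j|) +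
    Lam * (1 + ‖w.2.2‖ ^ 2) * ‖vGrad f w - vGrad f z‖ + Lam * |‖w.2.2‖ ^ 2 - ‖z.2.2‖ ^ 2|
  have hT : ContinuousAt (transportDeriv f) z := hf.transport_continuousOn.continuousAt hopen
  have hH : ∀ i j, ContinuousAt (fun z => vHess f z i j) z := fun i j =>
    hf.continuousAt_hess_apply hΩ hz i j
  have hG := hf.continuousAt_vGrad hΩ hz
  have hHs : ContinuousAt (fun w => ∑ i, ∑ j, Lam * |vHess f w i j - vHess f z i j|) z :=
    tendsto_finsetSum _ fun i _ => tendsto_finsetSum _ fun j _ =>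
      (continuousAt_const.mul ((hH i j).sub continuousAt_const).abs)
  have hE : ContinuousAt E z :=
    (((hT.sub continuousAt_const).abs.add hHs).add
      ((by fun_prop : ContinuousAt (fun w : Phase d => Lam * (1 + ‖w.2.2‖ ^ 2)) z).mul
        (hG.sub continuousAt_const).norm)).add (by fun_prop)
  have hE0 : E z = 0 := by simp [E]
  have hev : ∀ᶠ w in nhds z, E w < κ := hE.eventually (gt_mem_nhds (by rw [hE0]; exact hκ))
  have := isOpenPosMeasure_phase d
  -- `S z` itself may be exceptional, but points where the almost everywhere bound holds are dense.
  obtain ⟨w, hwS, ⟨hwE, hwU⟩⟩ := (Measure.dense_of_ae hS).inter_nhds_nonempty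
    (Filter.inter_mem hev hopen)
  have hwS : S w ≤ σ := hwS hwU
  have hwE : E w < κ := hwE
  have hpb : PointBounds lam Lam (Lam * (1 + ‖w.2.2‖ ^ 2)) (A w) (B w) :=
    ⟨hc.symm w hwU, hc.lower w hwU, hc.upper w hwU, hc.drift w hwU⟩
  have t1 : 0 ≤ |transportDeriv f w - transportDeriv f z| := abs_nonneg _
  have t2 : 0 ≤ ∑ i, ∑ j, Lam * |vHess f w i j - vHess f z i j| :=
    Finset.sum_nonneg fun i _ => Finset.sum_nonneg fun j _ =>
      mul_nonneg (hlam.trans hLam).le (abs_nonneg _)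
  have t3 : 0 ≤ Lam * (1 + ‖w.2.2‖ ^ 2) * ‖vGrad f w - vGrad f z‖ := by
    have := hlam.trans hLam; positivity
  have t4 : 0 ≤ Lam * |‖w.2.2‖ ^ 2 - ‖z.2.2‖ ^ 2| := by
    have := hlam.trans hLam; positivity
  have hLpos := hlam.trans hLam
  refine ⟨A w, B w, ⟨hpb.symm, hpb.lower, hpb.upper, hpb.drift.trans ?_⟩, ?_⟩
  · have : Lam * (‖w.2.2‖ ^ 2 - ‖z.2.2‖ ^ 2) ≤ Lam * |‖w.2.2‖ ^ 2 - ‖z.2.2‖ ^ 2| := by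
      gcongr; exact le_abs_self _
    simp only [E] at hwE
    linarith
  · have e := hf.equation w hwU
    have s1 : (∑ i, ∑ j, A w i j * vHess f w i j) ≤ (∑ i, ∑ j, A w i j * vHess f z i j) +
        ∑ i, ∑ j, Lam * |vHess f w i j - vHess f z i j| := by
      simp only [← Finset.sum_add_distrib]
      refine Finset.sum_le_sum fun i _ => Finset.sum_le_sum fun j _ => ?_
      have := le_abs_self (A w i j * (vHess f w i j - vHess f z i j))
      rw [abs_mul] at this
      have h2 : |A w i j| * |vHess f w i j - vHess f z i j| ≤
          Lam * |vHess f w i j - vHess f z i j| := by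
        gcongr; exact hpb.abs_apply_le hlam i j
      linarith
    have s2 : inner ℝ (B w) (vGrad f w) ≤ inner ℝ (B w) (vGrad f z) +
        Lam * (1 + ‖w.2.2‖ ^ 2) * ‖vGrad f w - vGrad f z‖ := by
      have h1 := real_inner_le_norm (B w) (vGrad f w - vGrad f z)
      rw [inner_sub_right] at h1
      have h2 : ‖B w‖ * ‖vGrad f w - vGrad f z‖ ≤
          Lam * (1 + ‖w.2.2‖ ^ 2) * ‖vGrad f w - vGrad f z‖ := by
        gcongr; exact hpb.drift
      linarith
    have s3 := neg_abs_le (transportDeriv f w - transportDeriv f z)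
    simp only [E] at hwE
    linarith

open Matrix MatrixOrder in
/-- The trace of the product of a nonnegative and a nonpositive form is nonpositive. -/
lemma sum_mul_nonpos {A Q : Matrix (Fin d) (Fin d) ℝ} (hs : A.IsSymm)
    (hA : ∀ ξ : Vec d, 0 ≤ ∑ i, ∑ j, A i j * ξ i * ξ j)
    (hQ : ∀ ξ : Vec d, ∑ i, ∑ j, Q i j * ξ i * ξ j ≤ 0) : ∑ i, ∑ j, A i j * Q i j ≤ 0 := by
  have hpsd : A.PosSemidef := by
    refine Matrix.PosSemidef.of_dotProduct_mulVec_nonneg ?_ fun x => ?_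
    · rw [Matrix.IsHermitian, conjTranspose_eq_transpose_of_trivial]; exact hs
    · have := hA (WithLp.toLp 2 x)
      simp only [dotProduct, mulVec, star_trivial, Finset.mul_sum]
      refine this.trans_eq (Finset.sum_congr rfl fun i _ => Finset.sum_congr rfl fun j _ => ?_)
      simp only []
      ring
  -- Writing `A = CᵀC` turns the trace into a sum of values of the form `Q` at the rows of `C`.
  obtain ⟨C, hC⟩ := CStarAlgebra.nonneg_iff_eq_star_mul_self.1 hpsd.nonneg
  have : ∀ i j, A i j = ∑ k, C k i * C k j := by
    intro i j
    rw [hC]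
    simp [Matrix.mul_apply, Matrix.star_apply]
  calc ∑ i, ∑ j, A i j * Q i j = ∑ k, ∑ i, ∑ j, Q i j * C k i * C k j := by
        simp only [this, Finset.sum_mul]
        rw [Finset.sum_comm' (t' := Finset.univ) (s' := fun _ => Finset.univ) (by simp)]
        conv_rhs => rw [Finset.sum_comm]; enter [2, i]; rw [Finset.sum_comm]
        rw [Finset.sum_comm]
        refine Finset.sum_congr rfl fun i _ => Finset.sum_congr rfl fun j _ =>
          Finset.sum_congr rfl fun k _ => by ring
    _ ≤ 0 := Finset.sum_nonpos fun k _ => hQ (WithLp.toLp 2 (C k))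

/-- A positive second derivative would make `0` a local minimum too; then `g` would be locally
constant and the second derivative zero. -/
lemma second_deriv_nonpos_of_isLocalMax {g g' : ℝ → ℝ} {g₂ : ℝ}
    (h1 : ∀ᶠ s in nhds (0 : ℝ), HasDerivAt g (g' s) s) (h2 : HasDerivAt g' g₂ 0)
    (hm : IsLocalMax g 0) : g' 0 = 0 ∧ g₂ ≤ 0 := by
  have h0 : g' 0 = 0 := hm.hasDerivAt_eq_zero h1.self_of_nhds
  refine ⟨h0, ?_⟩
  by_contra! hpos
  have hd : deriv g =ᶠ[nhds 0] g' := h1.mono fun s hs => hs.deriv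
  have hdd : deriv (deriv g) 0 = g₂ := by rw [hd.deriv_eq, h2.deriv]
  have hmin : IsLocalMin g 0 := isLocalMin_of_deriv_deriv_pos (by rw [hdd]; exact hpos)
    (by rw [hd.self_of_nhds, h0]) h1.self_of_nhds.continuousAt
  have hconst : g =ᶠ[nhds 0] fun _ => g 0 := by
    filter_upwards [hm, hmin] with s a b using le_antisymm a b
  have : deriv (deriv g) 0 = 0 := by
    rw [hconst.deriv.deriv_eq]; simp
  linarith

end Touching

/-! ### Comparison principle with exponentiated quadratic barriers -/

section Comparison

variable {d : ℕ} {Ω : Set (Vec d)} {z₀ : Phase d} {r : ℝ}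

lemma isOpen_preimage_transport {O : Set (Phase d)} (hO : IsOpen O) {z : Phase d} (hz : z ∈ O) :
    ∀ᶠ s in nhds (0 : ℝ), ((z.1 + s, z.2.1 + s • z.2.2, z.2.2) : Phase d) ∈ O := by
  have h1 : Continuous fun s : ℝ => ((z.1 + s, z.2.1 + s • z.2.2, z.2.2) : Phase d) := by fun_prop
  exact h1.continuousAt.eventually (hO.mem_nhds (by simpa using hz))

lemma eventually_vShift_mem {O : Set (Phase d)} (hO : IsOpen O) {z : Phase d} (hz : z ∈ O)
    (ξ : Vec d) : ∀ᶠ s in nhds (0 : ℝ), vShift z s ξ ∈ O := by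
  have h1 : Continuous fun s : ℝ => vShift z s ξ := by unfold vShift; fun_prop
  exact h1.continuousAt.eventually (hO.mem_nhds (by simpa [vShift] using hz))

/-- The position is moved into `Ω` and the time slightly back. This lets continuity carry
information between the interior and both `∂Ω` and the final time. -/
lemma domCyl_subset_closure (Ω : Set (Vec d)) (r : ℝ) (z₀ : Phase d) :
    domCyl Ω r z₀ ⊆ closure (domCylInterior Ω r z₀) := by
  rintro z ⟨⟨h1, h2, h3, h4⟩, h5⟩
  rw [mem_closure_iff_nhds]
  intro N hN
  have hO : IsOpen {w : Phase d | z₀.1 - r ^ 2 < w.1 ∧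
      ‖w.2.1 - z₀.2.1 - (w.1 - z₀.1) • z₀.2.2‖ < r ^ 3 ∧ ‖w.2.2 - z₀.2.2‖ < r} := by
    have a1 : IsOpen {z : Phase d | z₀.1 - r ^ 2 < z.1} := isOpen_lt (by fun_prop) (by fun_prop)
    have a3 : IsOpen {z : Phase d | ‖z.2.1 - z₀.2.1 - (z.1 - z₀.1) • z₀.2.2‖ < r ^ 3} :=
      isOpen_lt (by fun_prop) (by fun_prop)
    have a4 : IsOpen {z : Phase d | ‖z.2.2 - z₀.2.2‖ < r} := isOpen_lt (by fun_prop) (by fun_prop)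
    exact a1.inter (a3.inter a4)
  have hN' := Filter.inter_mem hN (hO.mem_nhds ⟨h1, h3, h4⟩)
  obtain ⟨V, hV, W, hW, hVW⟩ := mem_nhds_prod_iff.1 hN'
  obtain ⟨V', hV', W', hW', hVW'⟩ := mem_nhds_prod_iff.1 hW
  obtain ⟨x, hx1, hx2⟩ := mem_closure_iff_nhds.1 h5 V' hV'
  obtain ⟨l, hl, hlV⟩ := exists_Ioc_subset_of_mem_nhds hV ⟨z.1 - 1, by linarith⟩
  set t := (l + z.1) / 2 with ht
  have htl : l < t := by rw [ht]; linarith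
  have htz : t < z.1 := by rw [ht]; linarith
  have hmem : ((t, x, z.2.2) : Phase d) ∈ V ×ˢ W :=
    ⟨hlV ⟨htl, htz.le⟩, hVW' ⟨hx1, mem_of_mem_nhds hW'⟩⟩
  obtain ⟨b1, b2, b3, b4⟩ := hVW hmem
  exact ⟨_, b1, ⟨b2, (htz.trans_le h2).le, b3, b4⟩, htz.trans_le h2, hx2⟩

lemma hasDerivAt_gaussian (μ a β : ℝ) (u ξ : Vec d) (s : ℝ) :
    HasDerivAt (fun s : ℝ => Real.exp (-μ * (β + a * ‖u + s • ξ‖ ^ 2)))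
      (Real.exp (-μ * (β + a * ‖u + s • ξ‖ ^ 2)) *
        (-μ * (a * (2 * inner ℝ u ξ + 2 * s * ‖ξ‖ ^ 2)))) s := by
  have h0 : ∀ s : ℝ, ‖u + s • ξ‖ ^ 2 = ‖u‖ ^ 2 + 2 * (s * inner ℝ u ξ) + s ^ 2 * ‖ξ‖ ^ 2 := by
    intro s
    rw [norm_add_sq_real, inner_smul_right, norm_smul, mul_pow, Real.norm_eq_abs, sq_abs]
  have h1 : HasDerivAt (fun s : ℝ => ‖u + s • ξ‖ ^ 2) (2 * inner ℝ u ξ + 2 * s * ‖ξ‖ ^ 2) s := by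
    simp only [h0]
    have := ((((hasDerivAt_id s).mul_const (inner ℝ u ξ : ℝ)).const_mul 2).const_add (‖u‖ ^ 2)).add
      ((hasDerivAt_pow 2 s).mul_const (‖ξ‖ ^ 2))
    exact this.congr_deriv (by simp)
  exact (((h1.const_mul a).const_add β).const_mul (-μ)).exp

lemma hasDerivAt_gaussian_deriv (μ a β : ℝ) (u ξ : Vec d) :
    HasDerivAt (fun s : ℝ => Real.exp (-μ * (β + a * ‖u + s • ξ‖ ^ 2)) *
        (-μ * (a * (2 * inner ℝ u ξ + 2 * s * ‖ξ‖ ^ 2))))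
      (Real.exp (-μ * (β + a * ‖u‖ ^ 2)) * ((μ * (2 * a * inner ℝ u ξ)) ^ 2 -
        μ * (2 * a * ‖ξ‖ ^ 2))) 0 := by
  have h1 := hasDerivAt_gaussian μ a β u ξ 0
  have h2 : HasDerivAt (fun s : ℝ => -μ * (a * (2 * inner ℝ u ξ + 2 * s * ‖ξ‖ ^ 2)))
      (-μ * (a * (2 * ‖ξ‖ ^ 2))) 0 := by
    have := (((((hasDerivAt_id (0 : ℝ)).const_mul 2).mul_const (‖ξ‖ ^ 2)).const_add
      (2 * inner ℝ u ξ : ℝ)).const_mul a).const_mul (-μ)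
    exact this.congr_deriv (by simp)
  refine (h1.mul h2).congr_deriv ?_
  simp
  ring

variable {A : Phase d → Matrix (Fin d) (Fin d) ℝ} {B : Phase d → Vec d} {S f : Phase d → ℝ}

/-- At an interior local maximum in `v` of `f + m exp (-μ q)`, with `q` quadratic in `v`, the first
two derivatives of `f` in `v` are controlled. -/
lemma IsClassicalSolution.derivs_of_velocity_max (hf : IsClassicalSolution Ω r z₀ A B S f)
    (hΩ : IsOpen Ω) {z : Phase d} (hz : z ∈ domCylInterior Ω r z₀) {m μ a β : ℝ} {v₁ : Vec d}
    (hmax : ∀ ξ : Vec d, IsLocalMax (fun s : ℝ => f (vShift z s ξ) +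
      m * Real.exp (-μ * (β + a * ‖z.2.2 - v₁ + s • ξ‖ ^ 2))) 0) :
    vGrad f z = (m * μ * Real.exp (-μ * (β + a * ‖z.2.2 - v₁‖ ^ 2))) •
        ((2 * a) • (z.2.2 - v₁)) ∧
      ∀ ξ, hessForm f z ξ ≤ -(m * μ * Real.exp (-μ * (β + a * ‖z.2.2 - v₁‖ ^ 2))) *
        (μ * inner ℝ ((2 * a) • (z.2.2 - v₁)) ξ ^ 2 - 2 * a * ‖ξ‖ ^ 2) := by
  have key : ∀ ξ, fderiv ℝ (vSlice f z) z.2.2 ξ = (m * μ * Real.exp (-μ * (β + a * ‖z.2.2 - v₁‖ ^ 2)))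
        * inner ℝ ((2 * a) • (z.2.2 - v₁)) ξ ∧ hessForm f z ξ ≤
        -(m * μ * Real.exp (-μ * (β + a * ‖z.2.2 - v₁‖ ^ 2))) *
        (μ * inner ℝ ((2 * a) • (z.2.2 - v₁)) ξ ^ 2 - 2 * a * ‖ξ‖ ^ 2) := by
    intro ξ
    have hO := eventually_vShift_mem (isOpen_domCylInterior hΩ) hz ξ
    have e1 : ∀ᶠ s in nhds (0 : ℝ), HasDerivAt (fun s : ℝ => f (vShift z s ξ) +
        m * Real.exp (-μ * (β + a * ‖z.2.2 - v₁ + s • ξ‖ ^ 2)))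
        (fderiv ℝ (vSlice f z) (z.2.2 + s • ξ) ξ +
          m * (Real.exp (-μ * (β + a * ‖z.2.2 - v₁ + s • ξ‖ ^ 2)) *
        (-μ * (a * (2 * inner ℝ (z.2.2 - v₁) ξ + 2 * s * ‖ξ‖ ^ 2))))) s := by
      filter_upwards [hO] with s hs
      exact (hf.hasDerivAt_line ξ hs).add ((hasDerivAt_gaussian μ a β _ ξ s).const_mul m)
    have hz0 : vShift z 0 ξ = z := by simp [vShift]
    have e2 := (hf.hasDerivAt_line_fderiv ξ (s := 0) (by rw [hz0]; exact hz)).add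
      ((hasDerivAt_gaussian_deriv μ a β (z.2.2 - v₁) ξ).const_mul m)
    obtain ⟨h1, h2⟩ := second_deriv_nonpos_of_isLocalMax e1 e2 (hmax ξ)
    rw [hz0] at h2
    simp only [zero_smul, add_zero, mul_zero, zero_mul] at h1
    rw [inner_smul_left]
    simp only [RCLike.conj_to_real]
    constructor
    · linear_combination h1
    · linarith
  refine ⟨?_, fun ξ => (key ξ).2⟩
  refine ext_inner_right ℝ fun ξ => ?_
  rw [vGrad, inner_gradient, (key ξ).1, real_inner_smul_left ((2 * a) • (z.2.2 - v₁))]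

lemma sum_rank_one (p ξ : Vec d) (c c' : ℝ) :
    ∑ i, ∑ j, (c * (p i * p j) - c' * (1 : Matrix (Fin d) (Fin d) ℝ) i j) * ξ i * ξ j =
      c * inner ℝ p ξ ^ 2 - c' * ‖ξ‖ ^ 2 := by
  have h1 : (inner ℝ p ξ : ℝ) = ∑ i, p i * ξ i := by
    simp [PiLp.inner_apply, mul_comm]
  rw [h1, EuclideanSpace.norm_sq_eq, sq (∑ i, p i * ξ i), Finset.sum_mul_sum, Finset.mul_sum,
    Finset.mul_sum, ← Finset.sum_sub_distrib]
  refine Finset.sum_congr rfl fun i _ => ?_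
  simp only [sub_mul, Finset.sum_sub_distrib, Matrix.one_apply, mul_ite, mul_one, mul_zero, ite_mul,
    zero_mul, Finset.sum_ite_eq, Finset.mem_univ, if_true, Real.norm_eq_abs, sq_abs, Finset.mul_sum]
  congr 1
  · exact Finset.sum_congr rfl fun j _ => by ring
  · ring

/-- Since `A' ≥ 0`, pairing with `A'` preserves the inequality between the Hessian of `f` and the
model matrix `c p ⊗ p - c' I`. -/
lemma sum_coeff_le {lam Lam b : ℝ} {A' : Matrix (Fin d) (Fin d) ℝ} {B' : Vec d} (hlam : 0 ≤ lam)
    (h : PointBounds lam Lam b A' B') {z : Phase d} {p : Vec d} {c c' : ℝ}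
    (hH : ∀ ξ, hessForm f z ξ ≤ c * inner ℝ p ξ ^ 2 - c' * ‖ξ‖ ^ 2) :
    ∑ i, ∑ j, A' i j * vHess f z i j ≤ c * (∑ i, ∑ j, A' i j * p i * p j) - c' * A'.trace := by
  have h1 := sum_mul_nonpos (A := A')
    (Q := fun i j => vHess f z i j - (c * (p i * p j) - c' * (1 : Matrix (Fin d) (Fin d) ℝ) i j))
    h.symm (fun ξ => le_trans (by positivity) (h.lower ξ)) (fun ξ => by
      have e : ∑ i, ∑ j, (vHess f z i j - (c * (p i * p j) -
          c' * (1 : Matrix (Fin d) (Fin d) ℝ) i j)) * ξ i * ξ j = hessForm f z ξ -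
          ∑ i, ∑ j, (c * (p i * p j) - c' * (1 : Matrix (Fin d) (Fin d) ℝ) i j) * ξ i * ξ j := by
        rw [hessForm_eq_sum]
        simp only [← Finset.sum_sub_distrib, sub_mul]
      rw [e, sum_rank_one]
      linarith [hH ξ])
  have e2 : ∑ i, ∑ j, A' i j * (vHess f z i j - (c * (p i * p j) -
      c' * (1 : Matrix (Fin d) (Fin d) ℝ) i j)) = (∑ i, ∑ j, A' i j * vHess f z i j) -
      (c * (∑ i, ∑ j, A' i j * p i * p j) - c' * A'.trace) := by
    simp only [Matrix.trace, Matrix.diag, Finset.mul_sum, ← Finset.sum_sub_distrib]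
    refine Finset.sum_congr rfl fun i _ => ?_
    simp only [mul_sub, Finset.sum_sub_distrib, Matrix.one_apply, mul_ite, mul_one, mul_zero,
      Finset.sum_ite_eq, Finset.mem_univ, if_true]
    rw [mul_comm c' (A' i i)]
    congr 2
    exact Finset.sum_congr rfl fun j _ => by ring
  rw [e2] at h1
  linarith

set_option maxHeartbeats 1000000 in
/-- Comparison of a classical solution with `M - m (exp (-μ q) - exp (-μ))` on a compact set
`{q ≤ 1}`. On the part of the boundary where `y = 0` only the points with `⟪∇y, v⟫ ≥ 0` need
a bound. -/
lemma IsClassicalSolution.comparison (hf : IsClassicalSolution Ω r z₀ A B S f) (hΩ : IsOpen Ω)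
    {lam Lam σ : ℝ} (hlam : 0 < lam) (hLam : lam < Lam)
    (hc : CoeffBounds lam Lam A B (domCylInterior Ω r z₀))
    (hS : ∀ᵐ z ∂volume, z ∈ domCylInterior Ω r z₀ → S z ≤ σ)
    {K : Set (Phase d)} (hK : IsCompact K) (hKsub : K ⊆ domCyl Ω r z₀)
    {y : Vec d → ℝ} {gy : Vec d → Vec d} (hy : ∀ x, HasGradientAt y (gy x) x) (hgy : Continuous gy)
    (hyK : ∀ z ∈ K, 0 ≤ y z.2.1) (hyΩ : ∀ z ∈ K, 0 < y z.2.1 → z.2.1 ∈ Ω)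
    {q Tq : Phase d → ℝ} (hq : Continuous q)
    (hqT : ∀ z, HasDerivAt (alongTransport q z) (Tq z) 0)
    (hKq : ∀ z ∈ domCyl Ω r z₀, q z < 1 → z ∈ K)
    (hyint : ∀ z ∈ domCylInterior Ω r z₀, q z < 1 → 0 < y z.2.1)
    (hqpos : ∀ z ∈ K, 0 ≤ q z)
    {a : ℝ} {v₁ : Vec d} (hqv : ∀ z : Phase d, ∃ β, ∀ w, q (z.1, z.2.1, w) = β + a * ‖w - v₁‖ ^ 2)
    {M m μ c : ℝ} (hm : 0 < m) (hμ : 0 < μ) (hcpos : 0 < c)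
    (hσ : σ < m * μ * Real.exp (-μ) * c)
    (hkey : ∀ z ∈ K, ∀ A' B', PointBounds lam Lam (Lam * (1 + ‖z.2.2‖ ^ 2) + 1) A' B' →
      c ≤ Tq z + μ * (∑ i, ∑ j, A' i j * ((2 * a) • (z.2.2 - v₁)) i * ((2 * a) • (z.2.2 - v₁)) j) -
        2 * a * A'.trace - inner ℝ B' ((2 * a) • (z.2.2 - v₁)))
    (hM : ∀ z ∈ K, f z ≤ M)
    (hbd : ∀ z ∈ K, y z.2.1 = 0 → 0 ≤ inner ℝ (gy z.2.1) z.2.2 → f z ≤ M - m)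
    {z : Phase d} (hz : z ∈ K) :
    f z ≤ M - m * (Real.exp (-μ * q z) - Real.exp (-μ)) := by
  set D : Phase d → ℝ := fun z => f z - (M - m * (Real.exp (-μ * q z) - Real.exp (-μ))) with hD
  have hDc : ContinuousOn D (domCyl Ω r z₀) := hf.continuousOn.sub (by fun_prop)
  have hDle : ∀ z ∈ K, D z ≤ m := by
    intro z hz
    have h1 := hM z hz
    have h2 : Real.exp (-μ * q z) ≤ 1 := Real.exp_le_one_iff.2 (by nlinarith [hqpos z hz])
    have h3 := Real.exp_pos (-μ)
    have h4 : m * (Real.exp (-μ * q z) - Real.exp (-μ)) ≤ m * 1 := by gcongr; linarith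
    simp only [hD]; linarith
  have hDq : ∀ z ∈ K, 0 < D z → q z < 1 := by
    intro z hz hpos
    by_contra! hge
    have h1 := hM z hz
    have h2 : Real.exp (-μ * q z) ≤ Real.exp (-μ) := Real.exp_le_exp.2 (by nlinarith)
    have h4 : m * (Real.exp (-μ * q z) - Real.exp (-μ)) ≤ m * 0 := by gcongr; linarith
    simp only [hD] at hpos; linarith
  have hDbd : ∀ z ∈ K, y z.2.1 = 0 → 0 ≤ inner ℝ (gy z.2.1) z.2.2 → D z ≤ 0 := by
    intro z hz h1 h2
    have h3 := hbd z hz h1 h2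
    have h2 : Real.exp (-μ * q z) ≤ 1 := Real.exp_le_one_iff.2 (by nlinarith [hqpos z hz])
    have h3 := Real.exp_pos (-μ)
    have h4 : m * (Real.exp (-μ * q z) - Real.exp (-μ)) ≤ m * 1 := by gcongr; linarith
    simp only [hD]; linarith
  by_contra! hcon
  have hz0 : 0 < D z := by simp only [hD]; linarith
  have hyc : Continuous y := continuous_iff_continuousAt.2 fun x => (hy x).continuousAt
  -- an interior point with `D > 0`
  obtain ⟨z₁, hz₁, hz₁q, hz₁D⟩ : ∃ z₁ ∈ domCylInterior Ω r z₀, q z₁ < 1 ∧ 0 < D z₁ := by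
    have hcl := domCyl_subset_closure Ω r z₀ (hKsub hz)
    have e1 : ∀ᶠ w in nhdsWithin z (domCylInterior Ω r z₀), 0 < D w :=
      ((hDc z (hKsub hz)).mono (fun w hw => ⟨hw.1, subset_closure hw.2.2⟩)).eventually
        (lt_mem_nhds hz0)
    have e2 : ∀ᶠ w in nhdsWithin z (domCylInterior Ω r z₀), q w < 1 :=
      (hq.continuousAt.eventually (gt_mem_nhds (hDq z hz hz0))).filter_mono nhdsWithin_le_nhds
    have := mem_closure_iff_nhdsWithin_neBot.1 hcl
    obtain ⟨w, ⟨h1, h2⟩, h3⟩ := ((e1.and e2).and self_mem_nhdsWithin).exists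
    exact ⟨w, h3, h2, h1⟩
  have hz₁K : z₁ ∈ K := hKq _ ⟨hz₁.1, subset_closure hz₁.2.2⟩ hz₁q
  have hDK : ContinuousOn D K := hDc.mono hKsub
  have hwc : Continuous fun z : Phase d => (inner ℝ (gy z.2.1) z.2.2 : ℝ) := by fun_prop
  -- Where the velocity is not outgoing, `D ≤ 0` on `y = 0`; by compactness the points with `D ≥ D
  -- z₁ / 2` then keep a positive height. This is chosen before `ε`, so that the penalty error there
  -- is at most `ε * W / δ ^ 2`.
  obtain ⟨δ, hδ, hδy⟩ : ∃ δ > 0, ∀ z ∈ K, D z₁ / 2 ≤ D z → 0 ≤ inner ℝ (gy z.2.1) z.2.2 →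
      δ ≤ y z.2.1 := by
    have hcomp : IsCompact ({z ∈ K | D z ∈ Ici (D z₁ / 2)} ∩ {z | 0 ≤ inner ℝ (gy z.2.1) z.2.2}) :=
      (hK.of_isClosed_subset (hDK.preimage_isClosed_of_isClosed hK.isClosed isClosed_Ici)
        inter_subset_left).inter_right (isClosed_le continuous_const hwc)
    rcases ({z ∈ K | D z ∈ Ici (D z₁ / 2)} ∩
      {z | 0 ≤ inner ℝ (gy z.2.1) z.2.2}).eq_empty_or_nonempty with he | hne
    · refine ⟨1, one_pos, fun z h1 h2 h3 => ?_⟩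
      exact absurd (show z ∈ ({z ∈ K | D z ∈ Ici (D z₁ / 2)} ∩
        {z | 0 ≤ inner ℝ (gy z.2.1) z.2.2}) from ⟨⟨h1, h2⟩, h3⟩) (he ▸ notMem_empty z)
    · obtain ⟨p, ⟨⟨hp1, hp2⟩, hp3⟩, hpmin⟩ := hcomp.exists_isMinOn hne
        (f := fun z : Phase d => y z.2.1) (by fun_prop)
      refine ⟨y p.2.1, lt_of_le_of_ne (hyK p hp1) fun h0 => ?_, fun z h1 h2 h3 =>
        hpmin ⟨⟨h1, h2⟩, h3⟩⟩
      have := hDbd p hp1 h0.symm hp3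
      have hp2 : D z₁ / 2 ≤ D p := hp2
      linarith
  obtain ⟨W, hW⟩ := hK.exists_bound_of_continuousOn hwc.continuousOn
  have hW0 : 0 ≤ W := (norm_nonneg _).trans (hW z₁ hz₁K)
  -- The strictness of the supersolution; the penalty and the coefficient perturbation each consume
  -- a quarter of it.
  set g₀ := m * μ * Real.exp (-μ) * c - σ with hg₀
  have hg₀pos : 0 < g₀ := by rw [hg₀]; linarith
  have hy₁ := hyint z₁ hz₁ hz₁q
  have ht₁ : 0 < z₀.1 - z₁.1 := by linarith [hz₁.2.1]
  obtain ⟨ε, hε, hε1, hε2⟩ : ∃ ε > 0, ε * ((y z₁.2.1)⁻¹ + (z₀.1 - z₁.1)⁻¹) ≤ D z₁ / 2 ∧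
      ε * (W / δ ^ 2) ≤ g₀ / 4 := by
    set p := (y z₁.2.1)⁻¹ + (z₀.1 - z₁.1)⁻¹ with hp
    have hppos : 0 < p := by positivity
    refine ⟨min (D z₁ / 2 / p) (g₀ / 4 / (W / δ ^ 2 + 1)), by positivity, ?_, ?_⟩
    · calc _ ≤ (D z₁ / 2 / p) * p := by gcongr; exact min_le_left _ _
        _ = _ := by field_simp
    · calc _ ≤ (g₀ / 4 / (W / δ ^ 2 + 1)) * (W / δ ^ 2 + 1) := by
            gcongr
            · exact min_le_right _ _
            · linarith
        _ = _ := by field_simp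
  -- The penalties keep the maximum off `∂Ω` and off the final time, where no equation is available.
  set E : Phase d → ℝ := fun z => D z - ε * ((y z.2.1)⁻¹ + (z₀.1 - z.1)⁻¹) with hE
  -- As `D ≤ m` on `K`, a positive `E` forces each penalty below `m`, hence the cutoff `ε / m`.
  set Kε : Set (Phase d) := K ∩ {z | ε / m ≤ y z.2.1 ∧ ε / m ≤ z₀.1 - z.1} with hKε
  have hεm : 0 < ε / m := by positivity
  have hKεc : IsCompact Kε := by
    have c1 : IsClosed {z : Phase d | ε / m ≤ y z.2.1} := isClosed_le continuous_const (by fun_prop)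
    have c2 : IsClosed {z : Phase d | ε / m ≤ z₀.1 - z.1} :=
      isClosed_le continuous_const (by fun_prop)
    exact hK.inter_right (c1.inter c2)
  have hout : ∀ z ∈ K, 0 < y z.2.1 → 0 < z₀.1 - z.1 → 0 < E z → z ∈ Kε := by
    intro z hz h1 h2 h3
    have h4 := hDle z hz
    have h5 : 0 < (y z.2.1)⁻¹ := by positivity
    have h6 : 0 < (z₀.1 - z.1)⁻¹ := by positivity
    simp only [hE] at h3
    have h7 : 0 < ε * (y z.2.1)⁻¹ := by positivity
    have h8 : 0 < ε * (z₀.1 - z.1)⁻¹ := by positivity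
    rw [mul_add] at h3
    refine ⟨hz, ?_, ?_⟩
    · rw [div_le_iff₀ hm]
      have : ε * (y z.2.1)⁻¹ ≤ m := by linarith
      rwa [← div_eq_mul_inv, div_le_iff₀ h1, mul_comm] at this
    · rw [div_le_iff₀ hm]
      have : ε * (z₀.1 - z.1)⁻¹ ≤ m := by linarith
      rwa [← div_eq_mul_inv, div_le_iff₀ h2, mul_comm] at this
  have hE1 : D z₁ / 2 ≤ E z₁ := by simp only [hE]; linarith
  have hz₁ε : z₁ ∈ Kε := hout z₁ hz₁K hy₁ ht₁ (by linarith)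
  have hEc : ContinuousOn E Kε := by
    refine (hDK.mono inter_subset_left).sub (continuousOn_const.mul (ContinuousOn.add ?_ ?_))
    · exact ContinuousOn.inv₀ (by fun_prop) fun z hz => (hεm.trans_le hz.2.1).ne'
    · exact ContinuousOn.inv₀ (by fun_prop) fun z hz => (hεm.trans_le hz.2.2).ne'
  obtain ⟨p, hpK, hpmax⟩ := hKεc.exists_isMaxOn ⟨z₁, hz₁ε⟩ hEc
  have hEp : D z₁ / 2 ≤ E p := hE1.trans (hpmax hz₁ε)
  have hyp : 0 < y p.2.1 := hεm.trans_le hpK.2.1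
  have htp : 0 < z₀.1 - p.1 := hεm.trans_le hpK.2.2
  have hDp : D z₁ / 2 ≤ D p := by
    have : 0 < ε * ((y p.2.1)⁻¹ + (z₀.1 - p.1)⁻¹) := by positivity
    simp only [hE] at hEp
    linarith
  have hqp : q p < 1 := hDq p hpK.1 (by linarith)
  have hpU : p ∈ domCylInterior Ω r z₀ :=
    ⟨(hKsub hpK.1).1, by linarith, hyΩ p hpK.1 hyp⟩
  set O := domCylInterior Ω r z₀ ∩ {z | q z < 1} with hO
  have hOo : IsOpen O := (isOpen_domCylInterior hΩ).inter (isOpen_lt hq continuous_const)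
  have hpO : p ∈ O := ⟨hpU, hqp⟩
  have hmaxO : ∀ w ∈ O, E w ≤ E p := by
    intro w hw
    have hwK : w ∈ K := hKq w ⟨hw.1.1, subset_closure hw.1.2.2⟩ hw.2
    by_contra! hlt
    have := hpmax (hout w hwK (hyint w hw.1 hw.2) (by linarith [hw.1.2.1]) (by linarith))
    exact absurd hlt (not_lt.2 this)
  -- velocity derivatives at the maximum
  obtain ⟨β, hβ⟩ := hqv p
  have hqβ : q p = β + a * ‖p.2.2 - v₁‖ ^ 2 := hβ p.2.2
  obtain ⟨hgrad, hhess⟩ := hf.derivs_of_velocity_max hΩ hpU (m := m) (μ := μ) (a := a) (β := β)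
    (v₁ := v₁) (fun ξ => by
      filter_upwards [eventually_vShift_mem hOo hpO ξ] with s hs
      have h1 := hmaxO _ hs
      have h2 : q (vShift p s ξ) = β + a * ‖p.2.2 - v₁ + s • ξ‖ ^ 2 := by
        rw [vShift, hβ, add_sub_right_comm]
      simp only [hE, hD, h2, hqβ] at h1
      simp only [vShift] at h1
      simp only [vShift, zero_smul, add_zero]
      linarith)
  rw [← hqβ] at hgrad hhess
  -- transport derivative at the maximum
  set G := m * μ * Real.exp (-μ * q p) with hG
  have hGpos : 0 < G := by positivity
  have hTf : G * Tq p - g₀ / 4 ≤ transportDeriv f p := by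
    have d1 : HasDerivAt (alongTransport f p) (transportDeriv f p) 0 :=
      (hf.transport_differentiable p hpU).hasDerivAt
    have d2 := ((hqT p).const_mul (-μ)).exp.const_mul m
    have d3 : HasDerivAt (fun s : ℝ => y (p.2.1 + s • p.2.2)) (inner ℝ (gy p.2.1) p.2.2) 0 := by
      have h1 := (hy (p.2.1 + (0 : ℝ) • p.2.2)).hasFDerivAt
      have h2 : HasDerivAt (fun s : ℝ => p.2.1 + s • p.2.2) p.2.2 0 := by
        simpa using ((hasDerivAt_id (0 : ℝ)).smul_const p.2.2).const_add p.2.1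
      exact (h1.comp_hasDerivAt (0 : ℝ) h2).congr_deriv (by simp)
    have d4 : HasDerivAt (fun s : ℝ => z₀.1 - (p.1 + s)) (-1) 0 := by
      simpa using ((hasDerivAt_id (0 : ℝ)).const_add p.1).const_sub z₀.1
    have d5 := ((d3.inv (by simpa using hyp.ne')).add (d4.inv (by simpa using htp.ne'))).const_mul ε
    have d6 := (d1.add d2).sub d5
    have hloc : IsLocalMax ((alongTransport f p + fun s => m * Real.exp (-μ * alongTransport q p s)) -
        fun s => ε * ((fun s : ℝ => y (p.2.1 + s • p.2.2))⁻¹ + (fun s : ℝ => z₀.1 - (p.1 + s))⁻¹) s)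
        0 := by
      filter_upwards [isOpen_preimage_transport hOo hpO] with s hs
      have h1 := hmaxO _ hs
      simp only [hE, hD] at h1
      simp only [alongTransport, Pi.add_apply, Pi.sub_apply, Pi.inv_apply, zero_smul, add_zero]
      linarith
    have h0 := hloc.hasDerivAt_eq_zero d6
    simp only [alongTransport, zero_smul, add_zero, Prod.mk.eta, neg_neg] at h0
    -- For outgoing velocity the derivative of `1 / y` is positive, which helps; otherwise the
    -- height is at least `δ`.
    have hpen : -(W / δ ^ 2) ≤ -inner ℝ (gy p.2.1) p.2.2 / y p.2.1 ^ 2 := by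
      rcases le_or_gt 0 (inner ℝ (gy p.2.1) p.2.2) with hw | hw
      · have hδp := hδy p hpK.1 hDp hw
        have hWp := (le_abs_self _).trans (hW p hpK.1)
        rw [neg_div, neg_le_neg_iff]
        gcongr
      · have h1 : 0 < -inner ℝ (gy p.2.1) p.2.2 / y p.2.1 ^ 2 := by
          apply div_pos <;> [linarith; positivity]
        have h2 : 0 ≤ W / δ ^ 2 := by positivity
        linarith
    have hpen2 : 0 ≤ 1 / (z₀.1 - p.1) ^ 2 := by positivity
    have hpen3 : -(g₀ / 4) ≤ ε * (-inner ℝ (gy p.2.1) p.2.2 / y p.2.1 ^ 2 +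
        1 / (z₀.1 - p.1) ^ 2) := by
      have : ε * (-(W / δ ^ 2)) ≤ ε * (-inner ℝ (gy p.2.1) p.2.2 / y p.2.1 ^ 2 +
        1 / (z₀.1 - p.1) ^ 2) := by gcongr; linarith
      linarith
    have h0' : transportDeriv f p = G * Tq p + ε * (-inner ℝ (gy p.2.1) p.2.2 / y p.2.1 ^ 2 +
        1 / (z₀.1 - p.1) ^ 2) := by
      rw [hG]; linear_combination h0
    linarith
  -- the equation at the maximum
  obtain ⟨A', B', hAB, hle⟩ := hf.exists_coeff hΩ hlam hLam hc hS hpU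
    (κ := min 1 (g₀ / 4)) (by positivity)
  have hAB' : PointBounds lam Lam (Lam * (1 + ‖p.2.2‖ ^ 2) + 1) A' B' :=
    ⟨hAB.symm, hAB.lower, hAB.upper, hAB.drift.trans (by gcongr; exact min_le_left _ _)⟩
  have hk := hkey p hpK.1 A' B' hAB'
  have hsum := sum_coeff_le (f := f) (z := p) (p := (2 * a) • (p.2.2 - v₁)) (c := -(G * μ))
    (c' := -(G * (2 * a))) hlam.le hAB' (fun ξ => (hhess ξ).trans_eq (by ring))
  rw [hgrad, inner_smul_right] at hle
  have hκ := min_le_right 1 (g₀ / 4)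
  have hGk := mul_le_mul_of_nonneg_left hk hGpos.le
  -- With `q p < 1` the supersolution gap at `p` is at least `σ + g₀`, while the equation and the
  -- penalty leave at most `σ + g₀ / 2`.
  have hGe : m * μ * Real.exp (-μ) * c ≤ G * c := by
    rw [hG]
    gcongr
    nlinarith
  nlinarith

end Comparison

/-! ### The explicit barrier at a grazing or incoming point -/

section Barrier

variable {d : ℕ} {Ω : Set (Vec d)} {z₀ : Phase d} {r : ℝ}

/-- A boundary graph around the position of `z₀ ∈ Σ₀ ∪ Σ₋`, with quantitative bounds. -/
structure IsAdaptedChart (Ω : Set (Vec d)) (z₀ : Phase d) (e : Vec d) (γ : Vec d → ℝ)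
    (R L ρ : ℝ) (K : ℝ≥0) : Prop where
  graph : IsBoundaryGraph Ω z₀.2.1 R e γ
  lipschitz : LipschitzWith K (gradient (heightAbove e γ))
  gradient_le : ‖gradient (heightAbove e γ) z₀.2.1‖ ≤ L
  mem_frontier : z₀.2.1 ∈ frontier Ω
  inner_nonpos : inner ℝ (gradient (heightAbove e γ) z₀.2.1) z₀.2.2 ≤ (0 : ℝ)
  velocity_le : ‖z₀.2.2‖ ≤ ρ

/-- The barrier, with `h` the height above the boundary graph. -/
def barrier (h : Vec d → ℝ) (v₁ : Vec d) (z₀ : Phase d) (k r : ℝ) (z : Phase d) : ℝ :=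
  k / r ^ 3 * (-h z.2.1) + 2 / r ^ 2 * (z₀.1 - z.1) +
    4 / r ^ 6 * ‖z.2.1 - z₀.2.1 - (z.1 - z₀.1) • z₀.2.2‖ ^ 2 + 4 / r ^ 2 * ‖z.2.2 - v₁‖ ^ 2

/-- The transport derivative of the barrier. -/
def barrierTransport (h : Vec d → ℝ) (z₀ : Phase d) (k r : ℝ) (z : Phase d) : ℝ :=
  k / r ^ 3 * (-inner ℝ (gradient h z.2.1) z.2.2) - 2 / r ^ 2 + 8 / r ^ 6 *
    inner ℝ (z.2.1 - z₀.2.1 - (z.1 - z₀.1) • z₀.2.2) (z.2.2 - z₀.2.2)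

lemma hasDerivAt_barrier {h : Vec d → ℝ} (hh : Differentiable ℝ h) (v₁ : Vec d) (z₀ : Phase d)
    (k r : ℝ) (z : Phase d) :
    HasDerivAt (alongTransport (barrier h v₁ z₀ k r) z) (barrierTransport h z₀ k r z) 0 := by
  have d1 : HasDerivAt (fun s : ℝ => h (z.2.1 + s • z.2.2)) (inner ℝ (gradient h z.2.1) z.2.2) 0 := by
    have h1 := (hh (z.2.1 + (0 : ℝ) • z.2.2)).hasFDerivAt
    have h2 : HasDerivAt (fun s : ℝ => z.2.1 + s • z.2.2) z.2.2 0 := by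
      simpa using ((hasDerivAt_id (0 : ℝ)).smul_const z.2.2).const_add z.2.1
    exact (h1.comp_hasDerivAt (0 : ℝ) h2).congr_deriv (by simp)
  have d2 : HasDerivAt (fun s : ℝ => z₀.1 - (z.1 + s)) (-1) 0 := by
    simpa using ((hasDerivAt_id (0 : ℝ)).const_add z.1).const_sub z₀.1
  have d3 : HasDerivAt (fun s : ℝ => z.2.1 + s • z.2.2 - z₀.2.1 - (z.1 + s - z₀.1) • z₀.2.2)
      (z.2.2 - z₀.2.2) 0 := by
    have h1 : HasDerivAt (fun s : ℝ => z.2.1 + s • z.2.2 - z₀.2.1) z.2.2 0 := by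
      simpa using (((hasDerivAt_id (0 : ℝ)).smul_const z.2.2).const_add z.2.1).sub_const z₀.2.1
    have h2 : HasDerivAt (fun s : ℝ => (z.1 + s - z₀.1) • z₀.2.2) z₀.2.2 0 := by
      simpa using (((hasDerivAt_id (0 : ℝ)).const_add z.1).sub_const z₀.1).smul_const z₀.2.2
    exact h1.sub h2
  have d4 := ((((d1.neg.const_mul (k / r ^ 3)).add (d2.const_mul (2 / r ^ 2))).add
    (d3.norm_sq.const_mul (4 / r ^ 6))).add_const (4 / r ^ 2 * ‖z.2.2 - v₁‖ ^ 2))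
  refine HasDerivAt.congr_deriv (f' := _) d4 ?_
  simp only [barrierTransport, zero_smul, add_zero]
  ring

variable {e : Vec d} {γ : Vec d → ℝ} {R L ρ lam Lam : ℝ} {K : ℝ≥0}

/-- The cylinder drifts with velocity `v₀`, so positions spread over `r ^ 2`, not merely `r ^ 3`. -/
lemma norm_sub_le_of_mem_cyl {x : Vec d} {t s : ℝ} (hr1 : r ≤ 1) (hr : 0 < r)
    (hv : ‖z₀.2.2‖ ≤ ρ) (ht : |t - z₀.1| ≤ s ^ 2) (hs : 0 ≤ s) (hsr : s ≤ r)
    (hx : ‖x - z₀.2.1 - (t - z₀.1) • z₀.2.2‖ ≤ s ^ 3) : ‖x - z₀.2.1‖ ≤ r ^ 2 * (ρ + 1) := by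
  have h1 := norm_add_le (x - z₀.2.1 - (t - z₀.1) • z₀.2.2) ((t - z₀.1) • z₀.2.2)
  rw [sub_add_cancel, norm_smul, Real.norm_eq_abs] at h1
  have h2 : |t - z₀.1| * ‖z₀.2.2‖ ≤ r ^ 2 * ρ := by
    have : s ^ 2 ≤ r ^ 2 := by gcongr
    gcongr
    linarith
  have h3 : s ^ 3 ≤ r ^ 2 := by
    calc s ^ 3 ≤ r ^ 3 := by gcongr
      _ = r ^ 2 * r := by ring
      _ ≤ r ^ 2 * 1 := by gcongr
      _ = r ^ 2 := by ring
  linarith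

/-- The center of the barrier in velocity, slightly inside the domain of inflow. -/
def barrierCenter (h : Vec d → ℝ) (z₀ : Phase d) (r : ℝ) : Vec d :=
  z₀.2.2 - (r / 4) • (‖gradient h z₀.2.1‖⁻¹ • gradient h z₀.2.1)

lemma IsAdaptedChart.norm_center_sub (hc : IsAdaptedChart Ω z₀ e γ R L ρ K) (hr : 0 < r) :
    ‖barrierCenter (heightAbove e γ) z₀ r - z₀.2.2‖ = r / 4 := by
  have h1 : ‖gradient (heightAbove e γ) z₀.2.1‖ ≠ 0 :=
    (one_pos.trans_le (hc.graph.one_le_norm_gradient z₀.2.1)).ne'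
  rw [barrierCenter, sub_sub_cancel_left, norm_neg, norm_smul, norm_smul, norm_inv, norm_norm,
    inv_mul_cancel₀ h1, mul_one, Real.norm_eq_abs, abs_of_pos (by linarith)]

/-- The shift by `r / 4` along the inward normal gives normal speed at least `(r / 4) * (15 / 16)`;
since `v₀` is not outgoing, only the turning of the gradient between `x₀` and `x` is lost, at most
`r / 16` by `hK`. -/
lemma IsAdaptedChart.inward_velocity_ge (hc : IsAdaptedChart Ω z₀ e γ R L ρ K) (hr : 0 < r)
    (hr1 : r ≤ 1) (hK : K * (ρ + 1) ^ 2 * r ≤ 1 / 16) {x v : Vec d}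
    (hx : ‖x - z₀.2.1‖ ≤ r ^ 2 * (ρ + 1)) :
    r / 8 - (L + 1) * ‖v - barrierCenter (heightAbove e γ) z₀ r‖ ≤
      -inner ℝ (gradient (heightAbove e γ) x) v := by
  set g := gradient (heightAbove e γ) x
  set g₀ := gradient (heightAbove e γ) z₀.2.1 with hg₀
  set v₁ := barrierCenter (heightAbove e γ) z₀ r with hv₁
  have hρ : 0 ≤ ρ := (norm_nonneg _).trans hc.velocity_le
  have hg1 : 1 ≤ ‖g₀‖ := hc.graph.one_le_norm_gradient _
  have hd : ‖g - g₀‖ ≤ K * (r ^ 2 * (ρ + 1)) := by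
    have := hc.lipschitz.dist_le_mul x z₀.2.1
    rw [dist_eq_norm, dist_eq_norm] at this
    exact this.trans (by gcongr)
  have hd1 : K * (r ^ 2 * (ρ + 1)) * (ρ + 1) ≤ r / 16 := by
    calc K * (r ^ 2 * (ρ + 1)) * (ρ + 1) = r * (K * (ρ + 1) ^ 2 * r) := by ring
      _ ≤ r * (1 / 16) := by gcongr
      _ = r / 16 := by ring
  have hdρ : ‖g - g₀‖ * (ρ + 1) ≤ r / 16 := le_trans (by gcongr) hd1
  have hd2 : ‖g - g₀‖ ≤ r / 16 := by nlinarith [norm_nonneg (g - g₀)]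
  have e1 : inner ℝ (g - g₀) z₀.2.2 ≤ r / 16 := by
    refine (real_inner_le_norm _ _).trans (le_trans ?_ hdρ)
    gcongr
    linarith [hc.velocity_le]
  have e2 : inner ℝ g (v₁ - z₀.2.2) ≤ -(r / 4) * (1 - 1 / 16) := by
    have h1 : v₁ - z₀.2.2 = -((r / 4) • (‖g₀‖⁻¹ • g₀)) := by
      rw [hv₁, barrierCenter, sub_sub_cancel_left]
    have hn : ‖‖g₀‖⁻¹ • g₀‖ = 1 := by
      rw [norm_smul, norm_inv, norm_norm, inv_mul_cancel₀ (by linarith)]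
    have h2 : inner ℝ g (‖g₀‖⁻¹ • g₀) = inner ℝ (g - g₀) (‖g₀‖⁻¹ • g₀) + ‖g₀‖ := by
      rw [inner_sub_left, inner_smul_right g₀ g₀, real_inner_self_eq_norm_sq]
      field_simp
      ring
    have h3 := abs_real_inner_le_norm (g - g₀) (‖g₀‖⁻¹ • g₀)
    rw [hn, mul_one] at h3
    have h4 := neg_abs_le (inner ℝ (g - g₀) (‖g₀‖⁻¹ • g₀) : ℝ)
    rw [h1, inner_neg_right, inner_smul_right, h2]
    nlinarith
  have e3 : inner ℝ g (v - v₁) ≤ (L + 1) * ‖v - v₁‖ := by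
    refine (real_inner_le_norm _ _).trans ?_
    gcongr
    have := norm_sub_norm_le g g₀
    linarith [hc.gradient_le]
  have e4 : inner ℝ g v = inner ℝ g₀ z₀.2.2 + inner ℝ (g - g₀) z₀.2.2 + inner ℝ g (v₁ - z₀.2.2) +
      inner ℝ g (v - v₁) := by
    simp only [inner_sub_left, inner_sub_right]; ring
  have := hc.inner_nonpos
  rw [e4]
  linarith

/-- The rate of the barrier in the height. -/
def heightRate (d : ℕ) (Lam : ℝ) : ℝ := 56 + 64 * d * Lam

/-- The exponent of the barrier. -/
def barrierExponent (d : ℕ) (lam Lam L : ℝ) : ℝ :=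
  (heightRate d Lam * (L + 1) + 8) ^ 2 / (256 * lam)

/-- The ratio of consecutive radii. -/
def barrierRatio (d : ℕ) (Lam L : ℝ) : ℝ := (100 + heightRate d Lam * (L + 1))⁻¹

/-- Smallness of the radius. -/
structure IsSmallRadius (d : ℕ) (Lam R L ρ : ℝ) (K : ℝ≥0) (r : ℝ) : Prop where
  pos : 0 < r
  le_one : r ≤ 1
  curvature : K * (ρ + 1) ^ 2 * r ≤ barrierRatio d Lam L ^ 3 / 16
  chart : r ^ 2 * (ρ + 1) < R
  drift : (Lam * (1 + (ρ + 1) ^ 2) + 1) * r ≤ 1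

lemma heightRate_pos (d : ℕ) {Lam : ℝ} (h : 0 < Lam) : 0 < heightRate d Lam := by
  unfold heightRate; positivity

lemma barrierRatio_pos (d : ℕ) {Lam L : ℝ} (h : 0 < Lam) (hL : 0 ≤ L) :
    0 < barrierRatio d Lam L := by
  have := heightRate_pos d h
  unfold barrierRatio; positivity

lemma barrierRatio_le (d : ℕ) {Lam L : ℝ} (h : 0 < Lam) (hL : 0 ≤ L) :
    barrierRatio d Lam L ≤ 1 / 100 := by
  have := heightRate_pos d h
  rw [barrierRatio, ← one_div]
  gcongr
  have : 0 ≤ heightRate d Lam * (L + 1) := by positivity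
  linarith

lemma barrierRatio_mul_le (d : ℕ) {Lam L : ℝ} (h : 0 < Lam) (hL : 0 ≤ L) :
    heightRate d Lam * (L + 1) * barrierRatio d Lam L ≤ 1 := by
  have := heightRate_pos d h
  have h2 : 0 ≤ heightRate d Lam * (L + 1) := by positivity
  rw [barrierRatio, ← div_eq_mul_inv, div_le_one (by linarith)]
  linarith

lemma IsSmallRadius.curvature_le (h : IsSmallRadius d Lam R L ρ K r) (hLam : 0 < Lam)
    (hL : 0 ≤ L) : K * (ρ + 1) ^ 2 * r ≤ 1 / 16 := by
  have h1 := barrierRatio_le d hLam hL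
  have h2 := barrierRatio_pos d hLam hL
  have h3 : barrierRatio d Lam L ^ 3 ≤ 1 := pow_le_one₀ h2.le (by linarith)
  linarith [h.curvature]

lemma IsAdaptedChart.dist_lt (hc : IsAdaptedChart Ω z₀ e γ R L ρ K)
    (hs : IsSmallRadius d Lam R L ρ K r) {z : Phase d} (h1 : z₀.1 - r ^ 2 ≤ z.1) (h2 : z.1 ≤ z₀.1)
    (h3 : ‖z.2.1 - z₀.2.1 - (z.1 - z₀.1) • z₀.2.2‖ ≤ r ^ 3) :
    ‖z.2.1 - z₀.2.1‖ ≤ r ^ 2 * (ρ + 1) ∧ z.2.1 ∈ Metric.ball z₀.2.1 R := by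
  have : ‖z.2.1 - z₀.2.1‖ ≤ r ^ 2 * (ρ + 1) :=
    norm_sub_le_of_mem_cyl hs.le_one hs.pos hc.velocity_le
      (by rw [abs_le]; constructor <;> linarith [sq_nonneg r]) hs.pos.le le_rfl h3
  exact ⟨this, by rw [mem_ball_iff_norm]; exact this.trans_lt hs.chart⟩

/-- The set `{q ≤ 1}` stays away from the initial and lateral boundary of the cylinder. -/
lemma barrier_le_one {h : Vec d → ℝ} {v₁ : Vec d} {k : ℝ} (hr : 0 < r) (hk : 0 < k)
    (hv₁ : ‖v₁ - z₀.2.2‖ = r / 4) {z : Phase d} (hz : h z.2.1 ≤ 0) (ht : z.1 ≤ z₀.1)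
    (hq : barrier h v₁ z₀ k r z ≤ 1) :
    z₀.1 - r ^ 2 / 2 ≤ z.1 ∧ ‖z.2.1 - z₀.2.1 - (z.1 - z₀.1) • z₀.2.2‖ ≤ r ^ 3 / 2 ∧
      ‖z.2.2 - z₀.2.2‖ ≤ 3 * r / 4 := by
  unfold barrier at hq
  set X := ‖z.2.1 - z₀.2.1 - (z.1 - z₀.1) • z₀.2.2‖
  have a1 : 0 ≤ k / r ^ 3 * (-h z.2.1) := mul_nonneg (by positivity) (by linarith)
  have a2 : 0 ≤ 2 / r ^ 2 * (z₀.1 - z.1) := mul_nonneg (by positivity) (by linarith)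
  have a3 : 0 ≤ 4 / r ^ 6 * X ^ 2 := by positivity
  have a4 : 0 ≤ 4 / r ^ 2 * ‖z.2.2 - v₁‖ ^ 2 := by positivity
  refine ⟨?_, ?_, ?_⟩
  · have : 2 / r ^ 2 * (z₀.1 - z.1) ≤ 1 := by linarith
    rw [div_mul_eq_mul_div, div_le_one (by positivity)] at this
    linarith
  · have : 4 / r ^ 6 * X ^ 2 ≤ 1 := by linarith
    rw [div_mul_eq_mul_div, div_le_one (by positivity)] at this
    refine le_of_sq_le_sq ?_ (by positivity)
    nlinarith
  · have : 4 / r ^ 2 * ‖z.2.2 - v₁‖ ^ 2 ≤ 1 := by linarith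
    rw [div_mul_eq_mul_div, div_le_one (by positivity)] at this
    have h1 : ‖z.2.2 - v₁‖ ≤ r / 2 := by
      refine le_of_sq_le_sq ?_ (by positivity)
      nlinarith
    have := norm_sub_le_norm_sub_add_norm_sub z.2.2 v₁ z₀.2.2
    linarith

lemma PointBounds.trace_le {b : ℝ} {A : Matrix (Fin d) (Fin d) ℝ} {B : Vec d}
    (h : PointBounds lam Lam b A B) : A.trace ≤ d * Lam := by
  rw [Matrix.trace]
  calc ∑ i, A.diag i ≤ ∑ _i : Fin d, Lam := Finset.sum_le_sum fun i _ => (h.diag_mem i).2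
    _ = d * Lam := by simp

/-- The barrier is a supersolution after exponentiation. -/
lemma IsAdaptedChart.barrier_supersolution (hc : IsAdaptedChart Ω z₀ e γ R L ρ K)
    (hs : IsSmallRadius d Lam R L ρ K r) (hlam : 0 < lam) (hLam : 0 < Lam) (hL : 0 ≤ L)
    {z : Phase d} (hx : ‖z.2.1 - z₀.2.1‖ ≤ r ^ 2 * (ρ + 1))
    (hX : ‖z.2.1 - z₀.2.1 - (z.1 - z₀.1) • z₀.2.2‖ ≤ r ^ 3 / 2)
    (hv : ‖z.2.2 - z₀.2.2‖ ≤ 3 * r / 4) {A : Matrix (Fin d) (Fin d) ℝ} {B : Vec d}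
    (hAB : PointBounds lam Lam (Lam * (1 + ‖z.2.2‖ ^ 2) + 1) A B) :
    1 / r ^ 2 ≤ barrierTransport (heightAbove e γ) z₀ (heightRate d Lam) r z +
      barrierExponent d lam Lam L * (∑ i, ∑ j, A i j *
        ((2 * (4 / r ^ 2)) • (z.2.2 - barrierCenter (heightAbove e γ) z₀ r)) i *
        ((2 * (4 / r ^ 2)) • (z.2.2 - barrierCenter (heightAbove e γ) z₀ r)) j) -
      2 * (4 / r ^ 2) * A.trace -
      inner ℝ B ((2 * (4 / r ^ 2)) • (z.2.2 - barrierCenter (heightAbove e γ) z₀ r)) := by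
  have hr := hs.pos
  have hr1 := hs.le_one
  have hρ : 0 ≤ ρ := (norm_nonneg _).trans hc.velocity_le
  set v₁ := barrierCenter (heightAbove e γ) z₀ r
  set k := heightRate d Lam with hk
  have hkpos : 0 < k := heightRate_pos d hLam
  -- In the scaled velocity distance `τ` every term is `1 / r ^ 2` times a polynomial in `τ`.
  obtain ⟨τ, hτ⟩ : ∃ τ, τ = ‖z.2.2 - v₁‖ / r := ⟨_, rfl⟩
  have hτr : ‖z.2.2 - v₁‖ = τ * r := by rw [hτ]; field_simp
  have hτ0 : 0 ≤ τ := by rw [hτ]; positivity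
  have hw := hc.inward_velocity_ge hr hr1 (hs.curvature_le hLam hL) (v := z.2.2) hx
  have hpn : ‖(2 * (4 / r ^ 2)) • (z.2.2 - v₁)‖ = 8 * τ / r := by
    rw [norm_smul, hτr, Real.norm_eq_abs, abs_of_pos (by positivity)]
    field_simp
    ring
  -- The `5` is `2` from the time term plus `3` from the position term.
  have b1 : (1 / r ^ 2) * (k / 8 - k * (L + 1) * τ - 5) ≤
      barrierTransport (heightAbove e γ) z₀ k r z := by
    unfold barrierTransport
    have c1 : k / r ^ 3 * (r / 8 - (L + 1) * (τ * r)) ≤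
        k / r ^ 3 * (-inner ℝ (gradient (heightAbove e γ) z.2.1) z.2.2) := by
      rw [← hτr]; gcongr
    have c2 := abs_real_inner_le_norm (z.2.1 - z₀.2.1 - (z.1 - z₀.1) • z₀.2.2) (z.2.2 - z₀.2.2)
    have c3 : ‖z.2.1 - z₀.2.1 - (z.1 - z₀.1) • z₀.2.2‖ * ‖z.2.2 - z₀.2.2‖ ≤
        r ^ 3 / 2 * (3 * r / 4) := by gcongr
    have c4 : -(r ^ 3 / 2 * (3 * r / 4)) ≤
        inner ℝ (z.2.1 - z₀.2.1 - (z.1 - z₀.1) • z₀.2.2) (z.2.2 - z₀.2.2) :=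
      neg_le_of_abs_le (c2.trans c3)
    have c5 : 8 / r ^ 6 * (-(r ^ 3 / 2 * (3 * r / 4))) ≤ 8 / r ^ 6 *
        inner ℝ (z.2.1 - z₀.2.1 - (z.1 - z₀.1) • z₀.2.2) (z.2.2 - z₀.2.2) := by gcongr
    have c6 : 8 / r ^ 6 * (-(r ^ 3 / 2 * (3 * r / 4))) = -(3 / r ^ 2) := by
      field_simp; norm_num
    have c7 : k / r ^ 3 * (r / 8 - (L + 1) * (τ * r)) =
        1 / r ^ 2 * (k / 8 - k * (L + 1) * τ) := by field_simp
    have c8 : 1 / r ^ 2 * (k / 8 - k * (L + 1) * τ - 5) =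
        1 / r ^ 2 * (k / 8 - k * (L + 1) * τ) - 2 / r ^ 2 - 3 / r ^ 2 := by ring
    linarith
  have hμ : 0 ≤ barrierExponent d lam Lam L := by unfold barrierExponent; positivity
  have b2 : (1 / r ^ 2) * ((k * (L + 1) + 8) ^ 2 / 4 * τ ^ 2) ≤ barrierExponent d lam Lam L *
      (∑ i, ∑ j, A i j * ((2 * (4 / r ^ 2)) • (z.2.2 - v₁)) i *
        ((2 * (4 / r ^ 2)) • (z.2.2 - v₁)) j) := by
    refine le_trans (le_of_eq ?_) (mul_le_mul_of_nonneg_left (hAB.lower _) hμ)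
    rw [hpn, barrierExponent, ← hk]
    field_simp
    ring
  have b3 : 2 * (4 / r ^ 2) * A.trace ≤ (1 / r ^ 2) * (8 * d * Lam) := by
    refine (mul_le_mul_of_nonneg_left hAB.trace_le (by positivity)).trans_eq (by ring)
  have b4 : inner ℝ B ((2 * (4 / r ^ 2)) • (z.2.2 - v₁)) ≤ (1 / r ^ 2) * (8 * τ) := by
    refine (real_inner_le_norm _ _).trans ?_
    rw [hpn]
    have hvn : ‖z.2.2‖ ≤ ρ + 1 := by
      have := norm_sub_norm_le z.2.2 z₀.2.2
      linarith [hc.velocity_le]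
    have hB : ‖B‖ * r ≤ 1 := by
      refine le_trans ?_ hs.drift
      gcongr
      refine hAB.drift.trans ?_
      gcongr
    calc ‖B‖ * (8 * τ / r) = (‖B‖ * r) * (8 * τ / r ^ 2) := by field_simp
      _ ≤ 1 * (8 * τ / r ^ 2) := by gcongr
      _ = _ := by ring
  have b5 : (1 / r ^ 2) * 1 ≤ (1 / r ^ 2) * ((k / 8 - k * (L + 1) * τ - 5) +
      (k * (L + 1) + 8) ^ 2 / 4 * τ ^ 2 - 8 * d * Lam - 8 * τ) := by
    gcongr
    -- The choice of `heightRate` cancels the trace `8 * d * Lam` and leaves `7 - 5 = 2`; the choice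
    -- of `barrierExponent` completes the square, giving `1 + (1 - (k * (L + 1) + 8) / 2 * τ) ^ 2`.
    have hk8 : k / 8 = 7 + 8 * d * Lam := by rw [hk, heightRate]; ring
    nlinarith [sq_nonneg (1 - (k * (L + 1) + 8) / 2 * τ)]
  have b6 : (1 / r ^ 2) * ((k / 8 - k * (L + 1) * τ - 5) +
      (k * (L + 1) + 8) ^ 2 / 4 * τ ^ 2 - 8 * d * Lam - 8 * τ) =
      (1 / r ^ 2) * (k / 8 - k * (L + 1) * τ - 5) + (1 / r ^ 2) * ((k * (L + 1) + 8) ^ 2 / 4 * τ ^ 2)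
      - (1 / r ^ 2) * (8 * d * Lam) - (1 / r ^ 2) * (8 * τ) := by ring
  linarith

/-- The barrier is at most `3/4` in a smaller cylinder. -/
lemma IsAdaptedChart.barrier_le (hc : IsAdaptedChart Ω z₀ e γ R L ρ K) (hΩ : IsOpen Ω)
    (hs : IsSmallRadius d Lam R L ρ K r) (hLam : 0 < Lam) (hL : 0 ≤ L)
    {z : Phase d} (hz : z ∈ cyl (barrierRatio d Lam L * r) z₀) :
    barrier (heightAbove e γ) (barrierCenter (heightAbove e γ) z₀ r) z₀ (heightRate d Lam) r z
      ≤ 3 / 4 := by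
  have hr := hs.pos
  have hρ : 0 ≤ ρ := (norm_nonneg _).trans hc.velocity_le
  have hη := barrierRatio_pos d hLam hL
  have hη1 := barrierRatio_le d hLam hL
  have hη2 := barrierRatio_mul_le d hLam hL
  have hk := heightRate_pos d hLam
  obtain ⟨h1, h2, h3, h4⟩ := hz
  set η := barrierRatio d Lam L with hηdef
  set k := heightRate d Lam
  have hηr : η * r ≤ r := by nlinarith
  have hx : ‖z.2.1 - z₀.2.1‖ ≤ r ^ 2 * (ρ + 1) :=
    norm_sub_le_of_mem_cyl hs.le_one hr hc.velocity_le
      (by rw [abs_le]; constructor <;> linarith [sq_nonneg (η * r)]) (by positivity) hηr h3.le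
  have hT := hc.graph.abs_taylor_le hc.lipschitz z₀.2.1 z.2.1
  rw [hc.graph.eq_zero_of_mem_frontier hΩ (Metric.mem_ball_self hc.graph.r_pos) hc.mem_frontier,
    sub_zero] at hT
  have hT1 := neg_le_of_abs_le hT
  have hK2 : K * ‖z.2.1 - z₀.2.1‖ ^ 2 ≤ η ^ 3 * r ^ 3 := by
    calc K * ‖z.2.1 - z₀.2.1‖ ^ 2 ≤ K * (r ^ 2 * (ρ + 1)) ^ 2 := by gcongr
      _ = r ^ 3 * (K * (ρ + 1) ^ 2 * r) := by ring
      _ ≤ r ^ 3 * (η ^ 3 / 16) := by gcongr; exact hs.curvature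
      _ ≤ η ^ 3 * r ^ 3 := by
          have : 0 < η ^ 3 * r ^ 3 := by positivity
          linarith
  set g₀ := gradient (heightAbove e γ) z₀.2.1
  have hin : -(L * (η * r) ^ 3) ≤ inner ℝ g₀ (z.2.1 - z₀.2.1) := by
    have e1 : inner ℝ g₀ (z.2.1 - z₀.2.1) = inner ℝ g₀ (z.2.1 - z₀.2.1 - (z.1 - z₀.1) • z₀.2.2) +
        (z.1 - z₀.1) * inner ℝ g₀ z₀.2.2 := by
      rw [inner_sub_right _ _ ((z.1 - z₀.1) • z₀.2.2), inner_smul_right]; ring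
    -- The decisive sign: in the past of a non-outgoing point, the drift of order `r ^ 2` can only
    -- push positions out of `Ω`. The height inside therefore keeps the scale `r ^ 3`.
    have e2 : 0 ≤ (z.1 - z₀.1) * inner ℝ g₀ z₀.2.2 :=
      mul_nonneg_of_nonpos_of_nonpos (by linarith) hc.inner_nonpos
    have e3 := neg_le_of_abs_le (abs_real_inner_le_norm g₀ (z.2.1 - z₀.2.1 - (z.1 - z₀.1) • z₀.2.2))
    have e4 : ‖g₀‖ * ‖z.2.1 - z₀.2.1 - (z.1 - z₀.1) • z₀.2.2‖ ≤ L * (η * r) ^ 3 := by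
      gcongr; exact hc.gradient_le
    linarith
  have hy : -heightAbove e γ z.2.1 ≤ (L + 1) * (η ^ 3 * r ^ 3) := by
    have : L * (η * r) ^ 3 = L * (η ^ 3 * r ^ 3) := by ring
    linarith
  have hv := norm_sub_le_norm_sub_add_norm_sub z.2.2 z₀.2.2 (barrierCenter (heightAbove e γ) z₀ r)
  rw [norm_sub_rev z₀.2.2, hc.norm_center_sub hr] at hv
  have q1 : k / r ^ 3 * (-heightAbove e γ z.2.1) ≤ η ^ 2 := by
    calc k / r ^ 3 * (-heightAbove e γ z.2.1) ≤ k / r ^ 3 * ((L + 1) * (η ^ 3 * r ^ 3)) := by gcongr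
      _ = (k * (L + 1) * η) * η ^ 2 := by field_simp
      _ ≤ 1 * η ^ 2 := by gcongr
      _ = η ^ 2 := one_mul _
  have q2 : 2 / r ^ 2 * (z₀.1 - z.1) ≤ 2 * η ^ 2 := by
    calc 2 / r ^ 2 * (z₀.1 - z.1) ≤ 2 / r ^ 2 * (η * r) ^ 2 := by gcongr; linarith
      _ = _ := by field_simp
  have q3 : 4 / r ^ 6 * ‖z.2.1 - z₀.2.1 - (z.1 - z₀.1) • z₀.2.2‖ ^ 2 ≤ 4 * η ^ 6 := by
    calc _ ≤ 4 / r ^ 6 * ((η * r) ^ 3) ^ 2 := by gcongr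
      _ = _ := by field_simp
  -- The main contribution: the offset `r / 4` of the centre alone gives `1 / 4`; everything else is
  -- small with `η`.
  have q4 : 4 / r ^ 2 * ‖z.2.2 - barrierCenter (heightAbove e γ) z₀ r‖ ^ 2 ≤
      4 * (η + 1 / 4) ^ 2 := by
    calc _ ≤ 4 / r ^ 2 * (η * r + r / 4) ^ 2 := by gcongr; linarith
      _ = _ := by field_simp
  have q5 : η ^ 2 ≤ 1 / 100 := by nlinarith
  have q6 : η ^ 6 ≤ 1 / 100 := by
    calc η ^ 6 ≤ η ^ 2 := pow_le_pow_of_le_one hη.le (by linarith) (by norm_num)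
      _ ≤ _ := q5
  unfold barrier
  nlinarith

end Barrier

/-! ### One step of the oscillation decay -/

section OneStep

variable {d : ℕ} {Ω : Set (Vec d)} {z₀ : Phase d} {r r' : ℝ}
  {A : Phase d → Matrix (Fin d) (Fin d) ℝ} {B : Phase d → Vec d} {S f : Phase d → ℝ}

lemma cyl_subset_cyl (hr : 0 ≤ r) (h : r ≤ r') : cyl r z₀ ⊆ cyl r' z₀ := by
  rintro z ⟨h1, h2, h3, h4⟩
  have e1 : r ^ 2 ≤ r' ^ 2 := by gcongr
  have e2 : r ^ 3 ≤ r' ^ 3 := by gcongr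
  exact ⟨by linarith, h2, by linarith, by linarith⟩

lemma domCyl_subset_domCyl (hr : 0 ≤ r) (h : r ≤ r') : domCyl Ω r z₀ ⊆ domCyl Ω r' z₀ :=
  fun _ hz => ⟨cyl_subset_cyl hr h hz.1, hz.2⟩

lemma domCylInterior_subset (hr : 0 ≤ r) (h : r ≤ r') :
    domCylInterior Ω r z₀ ⊆ domCylInterior Ω r' z₀ :=
  fun _ hz => ⟨cyl_subset_cyl hr h hz.1, hz.2⟩

lemma IsClassicalSolution.mono (hf : IsClassicalSolution Ω r' z₀ A B S f) (hr : 0 ≤ r)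
    (h : r ≤ r') : IsClassicalSolution Ω r z₀ A B S f where
  continuousOn := hf.continuousOn.mono (domCyl_subset_domCyl hr h)
  transport_differentiable z hz := hf.transport_differentiable z (domCylInterior_subset hr h hz)
  transport_continuousOn := hf.transport_continuousOn.mono (domCylInterior_subset hr h)
  velocity_contDiffAt z hz := hf.velocity_contDiffAt z (domCylInterior_subset hr h hz)
  hess_continuousOn := hf.hess_continuousOn.mono (domCylInterior_subset hr h)
  equation z hz := hf.equation z (domCylInterior_subset hr h hz)

lemma CoeffBounds.mono {lam Lam : ℝ} {U V : Set (Phase d)} (h : CoeffBounds lam Lam A B V)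
    (hUV : U ⊆ V) : CoeffBounds lam Lam A B U :=
  ⟨fun z hz => h.symm z (hUV hz), fun z hz => h.lower z (hUV hz), fun z hz => h.upper z (hUV hz),
    fun z hz => h.drift z (hUV hz)⟩

/-- The gain of one step of the oscillation decay. -/
def barrierGain (d : ℕ) (lam Lam L : ℝ) : ℝ :=
  Real.exp (-barrierExponent d lam Lam L * (3 / 4)) - Real.exp (-barrierExponent d lam Lam L)

lemma barrierExponent_pos (d : ℕ) {lam Lam L : ℝ} (hlam : 0 < lam) (hLam : 0 < Lam) (hL : 0 ≤ L) :
    0 < barrierExponent d lam Lam L := by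
  have := heightRate_pos d hLam
  unfold barrierExponent
  positivity

lemma barrierGain_mem (d : ℕ) {lam Lam L : ℝ} (hlam : 0 < lam) (hLam : 0 < Lam) (hL : 0 ≤ L) :
    barrierGain d lam Lam L ∈ Ioo (0 : ℝ) 1 := by
  have h := barrierExponent_pos d hlam hLam hL
  have h1 : Real.exp (-barrierExponent d lam Lam L) <
      Real.exp (-barrierExponent d lam Lam L * (3 / 4)) := Real.exp_lt_exp.2 (by linarith)
  have h2 : Real.exp (-barrierExponent d lam Lam L * (3 / 4)) < 1 :=
    Real.exp_zero ▸ Real.exp_lt_exp.2 (by linarith)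
  have h3 := Real.exp_pos (-barrierExponent d lam Lam L)
  exact ⟨by unfold barrierGain; linarith, by unfold barrierGain; linarith⟩

/-- One step of the decay of the oscillation at a grazing or incoming boundary point. -/
lemma IsAdaptedChart.decay {e : Vec d} {γ : Vec d → ℝ} {R L ρ lam Lam σ : ℝ} {K : ℝ≥0}
    (hc : IsAdaptedChart Ω z₀ e γ R L ρ K) (hΩ : IsOpen Ω) (hΩb : Bornology.IsBounded Ω)
    (hs : IsSmallRadius d Lam R L ρ K r) (hlam : 0 < lam) (hLam : lam < Lam) (hL : 0 ≤ L)
    (hf : IsClassicalSolution Ω r z₀ A B S f)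
    (hcoef : CoeffBounds lam Lam A B (domCylInterior Ω r z₀))
    (hS : ∀ᵐ z ∂volume, z ∈ domCylInterior Ω r z₀ → S z ≤ σ) (hσ : 0 ≤ σ) {M b : ℝ}
    (hM : ∀ z ∈ domCyl Ω r z₀, f z ≤ M)
    (hb : ∀ z ∈ domCyl Ω r z₀, z.2.1 ∈ frontier Ω →
      inner ℝ (gradient (heightAbove e γ) z.2.1) z.2.2 ≤ (0 : ℝ) → f z ≤ b)
    {z : Phase d} (hz : z ∈ domCyl Ω (barrierRatio d Lam L * r) z₀) :
    f z ≤ (1 - barrierGain d lam Lam L) * M + barrierGain d lam Lam L * b +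
      Real.exp (barrierExponent d lam Lam L) / barrierExponent d lam Lam L * (σ * r ^ 2) := by
  have hLpos := hlam.trans hLam
  have hr := hs.pos
  have hη := barrierRatio_pos d hLpos hL
  have hη1 := barrierRatio_le d hLpos hL
  have hk := heightRate_pos d hLpos
  have hμ := barrierExponent_pos d hlam hLpos hL
  have hθ := barrierGain_mem d hlam hLpos hL
  have hzr : z ∈ domCyl Ω r z₀ := domCyl_subset_domCyl (by positivity) (by nlinarith) hz
  have hfM := hM z hzr
  set μ := barrierExponent d lam Lam L with hμdef
  set θ := barrierGain d lam Lam L with hθdef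
  set k := heightRate d Lam
  set v₁ := barrierCenter (heightAbove e γ) z₀ r
  set q := barrier (heightAbove e γ) v₁ z₀ k r with hq
  have hC : 0 < Real.exp μ / μ := by positivity
  have hCσ : 0 ≤ Real.exp μ / μ * (σ * r ^ 2) := by positivity
  -- Comparison with `m = M - b` needs the barrier to dominate the source. If it does not, `M - b`
  -- is already controlled by `σ * r ^ 2` and `f z ≤ M` suffices.
  rcases le_or_gt ((M - b) * μ * Real.exp (-μ) * (1 / r ^ 2)) σ with hcase | hcase
  · have h1 : M - b ≤ Real.exp μ / μ * (σ * r ^ 2) := by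
      calc M - b = ((M - b) * μ * Real.exp (-μ) * (1 / r ^ 2)) * (Real.exp μ / μ * r ^ 2) := by
            rw [Real.exp_neg]; field_simp
        _ ≤ σ * (Real.exp μ / μ * r ^ 2) := by gcongr
        _ = _ := by ring
    have h2 : θ * (M - b) ≤ Real.exp μ / μ * (σ * r ^ 2) := by
      rcases le_or_gt (M - b) 0 with h | h
      · nlinarith [hθ.1]
      · nlinarith [hθ.2]
    linarith
  have hm : 0 < M - b := by
    by_contra! hneg
    have : (M - b) * (μ * Real.exp (-μ) * (1 / r ^ 2)) ≤ 0 :=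
      mul_nonpos_of_nonpos_of_nonneg hneg (by positivity)
    linarith
  have hv₁ : ‖v₁ - z₀.2.2‖ = r / 4 := hc.norm_center_sub hr
  have hhc := hc.graph.continuous
  have hqc : Continuous q := by rw [hq]; unfold barrier; fun_prop
  have hneg : ∀ w ∈ domCyl Ω r z₀, heightAbove e γ w.2.1 ≤ 0 := fun w hw =>
    hc.graph.nonpos_of_mem_closure (hc.dist_lt hs hw.1.1.le hw.1.2.1 hw.1.2.2.1.le).2 hw.2
  have hball : ∀ w ∈ domCyl Ω r z₀, w.2.1 ∈ Metric.ball z₀.2.1 R := fun w hw =>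
    (hc.dist_lt hs hw.1.1.le hw.1.2.1 hw.1.2.2.1.le).2
  set Kc : Set (Phase d) := {w | w ∈ domCyl Ω r z₀ ∧ q w ≤ 1} with hKc
  have hKcomp : IsCompact Kc := by
    have c1 : IsClosed {w : Phase d | z₀.1 - r ^ 2 ≤ w.1} := isClosed_le (by fun_prop) (by fun_prop)
    have c2 : IsClosed {w : Phase d | w.1 ≤ z₀.1} := isClosed_le (by fun_prop) (by fun_prop)
    have c3 : IsClosed {w : Phase d | ‖w.2.1 - z₀.2.1 - (w.1 - z₀.1) • z₀.2.2‖ ≤ r ^ 3} :=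
      isClosed_le (by fun_prop) (by fun_prop)
    have c4 : IsClosed {w : Phase d | ‖w.2.2 - z₀.2.2‖ ≤ r} :=
      isClosed_le (by fun_prop) (by fun_prop)
    have c5 : IsClosed {w : Phase d | w.2.1 ∈ closure Ω} := isClosed_closure.preimage (by fun_prop)
    have c6 : IsClosed {w : Phase d | q w ≤ 1} := isClosed_le hqc (by fun_prop)
    have hcl := c1.inter (c2.inter (c3.inter (c4.inter (c5.inter c6))))
    -- The strict inequalities of the cylinder may be relaxed, because `q ≤ 1` restores them with
    -- room to spare.
    have heq : Kc = {w : Phase d | z₀.1 - r ^ 2 ≤ w.1} ∩ ({w : Phase d | w.1 ≤ z₀.1} ∩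
        ({w : Phase d | ‖w.2.1 - z₀.2.1 - (w.1 - z₀.1) • z₀.2.2‖ ≤ r ^ 3} ∩
        ({w : Phase d | ‖w.2.2 - z₀.2.2‖ ≤ r} ∩ ({w : Phase d | w.2.1 ∈ closure Ω} ∩
        {w : Phase d | q w ≤ 1})))) := by
      refine Subset.antisymm (fun w hw => ⟨hw.1.1.1.le, hw.1.1.2.1, hw.1.1.2.2.1.le,
        hw.1.1.2.2.2.le, hw.1.2, hw.2⟩) ?_
      rintro w ⟨h1, h2, h3, h4, h5, h6⟩
      have hwn := hc.graph.nonpos_of_mem_closure (hc.dist_lt hs h1 h2 h3).2 h5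
      obtain ⟨b1, b2, b3⟩ := barrier_le_one hr hk hv₁ hwn h2 h6
      have r2 : 0 < r ^ 2 := by positivity
      have r3 : 0 < r ^ 3 := by positivity
      exact ⟨⟨⟨by linarith, h2, by linarith, by linarith⟩, h5⟩, h6⟩
    rw [← heq] at hcl
    refine IsCompact.of_isClosed_subset (isCompact_Icc (a := z₀.1 - r ^ 2) (b := z₀.1) |>.prod
      ((Metric.isCompact_of_isClosed_isBounded isClosed_closure hΩb.closure).prod
        (isCompact_closedBall z₀.2.2 r))) hcl ?_
    rintro w ⟨⟨⟨h1, h2, h3, h4⟩, h5⟩, h6⟩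
    exact ⟨⟨h1.le, h2⟩, h5, by rw [mem_closedBall_iff_norm]; exact h4.le⟩
  have hKb : ∀ w ∈ Kc, ‖w.2.1 - z₀.2.1 - (w.1 - z₀.1) • z₀.2.2‖ ≤ r ^ 3 / 2 ∧
      ‖w.2.2 - z₀.2.2‖ ≤ 3 * r / 4 := fun w hw =>
    (barrier_le_one hr hk hv₁ (hneg w hw.1) hw.1.1.2.1 hw.2).2
  have hzq : q z ≤ 3 / 4 := hc.barrier_le hΩ hs hLpos hL hz.1
  have hgc := hc.lipschitz.continuous
  have key := hf.comparison hΩ hlam hLam hcoef hS hKcomp (fun w hw => hw.1)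
    (y := fun x => -heightAbove e γ x) (gy := fun x => -gradient (heightAbove e γ) x)
    (fun x => by
      have := (hc.graph.hasGradientAt x).hasFDerivAt.neg
      rw [hasGradientAt_iff_hasFDerivAt, map_neg]
      exact this) hgc.neg
    (fun w hw => by simpa using hneg w hw.1)
    (fun w hw h => (hc.graph.mem_iff _ (hball w hw.1)).2 (by simpa using h))
    hqc (hasDerivAt_barrier hc.graph.differentiable v₁ z₀ k r)
    (fun w hw h => ⟨hw, h.le⟩)
    (fun w hw h => by
      have hw' : w ∈ domCyl Ω r z₀ := ⟨hw.1, subset_closure hw.2.2⟩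
      simpa using (hc.graph.mem_iff _ (hball w hw')).1 hw.2.2)
    (fun w hw => by
      have h1 := hneg w hw.1
      have h2 := hw.1.1.2.1
      have a1 : 0 ≤ k / r ^ 3 * (-heightAbove e γ w.2.1) :=
        mul_nonneg (by positivity) (by linarith)
      have a2 : 0 ≤ 2 / r ^ 2 * (z₀.1 - w.1) := mul_nonneg (by positivity) (by linarith)
      rw [hq]; unfold barrier; positivity)
    (a := 4 / r ^ 2) (v₁ := v₁) (fun w => ⟨k / r ^ 3 * (-heightAbove e γ w.2.1) +
      2 / r ^ 2 * (z₀.1 - w.1) + 4 / r ^ 6 * ‖w.2.1 - z₀.2.1 - (w.1 - z₀.1) • z₀.2.2‖ ^ 2,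
      fun v => rfl⟩) hm hμ
    (by positivity : 0 < 1 / r ^ 2) hcase
    (fun w hw A' B' hAB => hc.barrier_supersolution hs hlam hLpos hL
      (hc.dist_lt hs hw.1.1.1.le hw.1.1.2.1 hw.1.1.2.2.1.le).1 (hKb w hw).1 (hKb w hw).2 hAB)
    (fun w hw => hM w hw.1)
    (fun w hw h1 h2 => by
      have h1 : heightAbove e γ w.2.1 = 0 := by simpa using h1
      have h2 : inner ℝ (gradient (heightAbove e γ) w.2.1) w.2.2 ≤ (0 : ℝ) := by simpa using h2
      have hfr : w.2.1 ∈ frontier Ω := by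
        rw [hΩ.frontier_eq]
        exact ⟨hw.1.2, fun hin => by
          have := (hc.graph.mem_iff _ (hball w hw.1)).1 hin
          linarith⟩
      linarith [hb w hw.1 hfr h2])
    (z := z) ⟨hzr, by linarith⟩
  have hexp : Real.exp (-μ * (3 / 4)) ≤ Real.exp (-μ * q z) := Real.exp_le_exp.2 (by nlinarith)
  have h1 : (M - b) * θ ≤ (M - b) * (Real.exp (-μ * q z) - Real.exp (-μ)) := by
    rw [hθdef, barrierGain, ← hμdef]
    gcongr
  linarith

end OneStep

/-! ### Norms, boundary data and the two notions of distance -/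

section Data

variable {d : ℕ} {Ω : Set (Vec d)} {z₀ : Phase d} {r : ℝ}
  {A : Phase d → Matrix (Fin d) (Fin d) ℝ} {B : Phase d → Vec d} {S f : Phase d → ℝ}

lemma ae_abs_le_supNorm {g : Phase d → ℝ} {U : Set (Phase d)}
    (hg : MemLp g ∞ (volume.restrict U)) :
    ∀ᵐ z ∂volume, z ∈ U → |g z| ≤ (supNorm g U).toReal := by
  refine ae_imp_of_ae_restrict ?_
  have h1 : supNorm g U ≠ ∞ := hg.eLpNorm_ne_top
  filter_upwards [ae_le_eLpNormEssSup (f := g) (μ := volume.restrict U)] with z hz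
  rw [← eLpNorm_exponent_top] at hz
  have := ENNReal.toReal_mono h1 hz
  simpa using this

/-- Continuity upgrades the essential bound to every point: density of a full-measure set handles
the open interior, and a limit handles the rest of the cylinder. -/
lemma IsClassicalSolution.abs_le_supNorm (hf : IsClassicalSolution Ω r z₀ A B S f) (hΩ : IsOpen Ω)
    (hfb : MemLp f ∞ (volume.restrict (domCyl Ω r z₀))) {z : Phase d} (hz : z ∈ domCyl Ω r z₀) :
    |f z| ≤ (supNorm f (domCyl Ω r z₀)).toReal := by
  have hae := ae_abs_le_supNorm hfb
  set N := (supNorm f (domCyl Ω r z₀)).toReal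
  have hsub : domCylInterior Ω r z₀ ⊆ domCyl Ω r z₀ := fun w hw => ⟨hw.1, subset_closure hw.2.2⟩
  have := isOpenPosMeasure_phase d
  have hint : ∀ w ∈ domCylInterior Ω r z₀, |f w| ≤ N := by
    intro w hw
    by_contra! hlt
    have hev := ((hf.continuousAt hΩ hw).abs.eventually (lt_mem_nhds hlt)).and
      ((isOpen_domCylInterior hΩ).mem_nhds hw)
    obtain ⟨p, hp1, hp2, hp3⟩ := (Measure.dense_of_ae hae).inter_nhds_nonempty hev
    have hp2 : N < |f p| := hp2
    exact absurd (hp1 (hsub hp3)) (not_le.2 hp2)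
  have hne := mem_closure_iff_nhdsWithin_neBot.1 (domCyl_subset_closure Ω r z₀ hz)
  refine le_of_tendsto ((hf.continuousOn z hz).mono hsub).abs ?_
  filter_upwards [self_mem_nhdsWithin] with w hw using hint w hw

lemma abs_sub_le_holderNorm {β : ℝ} {g : Phase d → ℝ} {K : Set (Phase d)}
    (hg : holderNorm β g K < ∞) {z z' : Phase d} (hz : z ∈ K) (hz' : z' ∈ K) :
    |g z - g z'| ≤ (holderNorm β g K).toReal * phaseNorm (z - z') ^ β := by
  rcases eq_or_ne z z' with rfl | hne
  · simp only [sub_self, abs_zero]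
    exact mul_nonneg ENNReal.toReal_nonneg (Real.rpow_nonneg (Real.sqrt_nonneg _) _)
  · have hpos : 0 < phaseNorm (z - z') := by
      refine Real.sqrt_pos.2 ?_
      by_contra! hle
      have h1 := sq_nonneg (z - z').1
      have h2 := sq_nonneg ‖(z - z').2.1‖
      have h3 := sq_nonneg ‖(z - z').2.2‖
      refine hne (sub_eq_zero.1 (Prod.ext ?_ (Prod.ext ?_ ?_)))
      · exact pow_eq_zero_iff (two_ne_zero) |>.1 (by linarith)
      · exact norm_eq_zero.1 (pow_eq_zero_iff (two_ne_zero) |>.1 (by linarith))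
      · exact norm_eq_zero.1 (pow_eq_zero_iff (two_ne_zero) |>.1 (by linarith))
    have h1 : ENNReal.ofReal (|g z - g z'| / phaseNorm (z - z') ^ β) ≤ holderNorm β g K := by
      refine le_trans ?_ le_add_self
      exact le_iSup₂_of_le z hz (le_iSup₂_of_le z' hz' (le_iSup_of_le hne le_rfl))
    have h2 := (ENNReal.ofReal_le_iff_le_toReal hg.ne).1 h1
    rwa [div_le_iff₀ (Real.rpow_pos_of_pos hpos _)] at h2

lemma continuous_phaseNorm : Continuous (phaseNorm (d := d)) := by
  unfold phaseNorm
  fun_prop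

lemma IsBoundaryGraph.isOutwardNormal {x₀ x e : Vec d} {R : ℝ} {γ : Vec d → ℝ}
    (h : IsBoundaryGraph Ω x₀ R e γ) (hx : x ∈ Metric.ball x₀ R) :
    IsOutwardNormal Ω x (‖gradient (heightAbove e γ) x‖⁻¹ • gradient (heightAbove e γ) x) :=
  ⟨R - dist x x₀, e, γ, h.recenter (by linarith [Metric.mem_ball.1 hx]) (by linarith), rfl⟩

/-- A point of `Σ₀ ∪ Σ₋` is a limit of points of `Σ₋` with the same time and position. -/
lemma IsBoundaryGraph.exists_incoming {x₀ e : Vec d} {R : ℝ} {γ : Vec d → ℝ}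
    (h : IsBoundaryGraph Ω x₀ R e γ) {z : Phase d} (hz : z ∈ cyl r z₀)
    (hx : z.2.1 ∈ Metric.ball x₀ R) (hfr : z.2.1 ∈ frontier Ω)
    (hin : inner ℝ (gradient (heightAbove e γ) z.2.1) z.2.2 ≤ (0 : ℝ)) :
    ∃ u : ℝ → Phase d, Filter.Tendsto u (nhdsWithin 0 (Ioi 0)) (nhds z) ∧
      ∀ᶠ s in nhdsWithin (0 : ℝ) (Ioi 0), u s ∈ cyl r z₀ ∩ incoming Ω := by
  set g := gradient (heightAbove e γ) z.2.1
  have hg : 0 < ‖g‖ := one_pos.trans_le (h.one_le_norm_gradient _)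
  -- Moving the velocity by `-s g` lowers its product with `g` by `s * ‖g‖ ^ 2`, so a grazing point
  -- becomes strictly incoming.
  have hc : Continuous fun s : ℝ => vShift z s (-g) := by unfold vShift; fun_prop
  have ht : Filter.Tendsto (fun s : ℝ => vShift z s (-g)) (nhdsWithin 0 (Ioi 0)) (nhds z) := by
    have := (hc.tendsto 0).mono_left (nhdsWithin_le_nhds (s := Ioi 0))
    simpa [vShift] using this
  refine ⟨_, ht, ?_⟩
  have hv : ∀ᶠ w in nhds z, ‖w.2.2 - z₀.2.2‖ < r :=
    (isOpen_lt (by fun_prop : Continuous fun w : Phase d => ‖w.2.2 - z₀.2.2‖)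
      continuous_const).mem_nhds hz.2.2.2
  filter_upwards [ht.eventually hv, self_mem_nhdsWithin] with s hs hs0
  have hs0 : (0 : ℝ) < s := hs0
  refine ⟨⟨hz.1, hz.2.1, hz.2.2.1, hs⟩, hfr, _, h.isOutwardNormal hx, ?_⟩
  simp only [vShift]
  rw [inner_smul_left, inner_add_right, inner_smul_right, inner_neg_right,
    real_inner_self_eq_norm_sq]
  simp only [RCLike.conj_to_real]
  have : 0 < s * ‖g‖ ^ 2 := by positivity
  exact mul_neg_of_pos_of_neg (by positivity) (by linarith)

/-- On `Σ₀ ∪ Σ₋` near `z₀` the solution inherits the Hölder bound of the boundary data. -/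
lemma IsClassicalSolution.abs_sub_le_of_boundary (hf : IsClassicalSolution Ω r z₀ A B S f)
    {e : Vec d} {γ : Vec d → ℝ} {R β : ℝ}
    (h : IsBoundaryGraph Ω z₀.2.1 R e γ) (hβ : 0 < β) {fb : Phase d → ℝ}
    (hfb : holderNorm β fb (cyl r z₀ ∩ incoming Ω) < ∞)
    (heq : ∀ z ∈ cyl r z₀ ∩ incoming Ω, f z = fb z) {z z' : Phase d}
    (hz : z ∈ cyl r z₀) (hx : z.2.1 ∈ Metric.ball z₀.2.1 R) (hfr : z.2.1 ∈ frontier Ω)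
    (hin : inner ℝ (gradient (heightAbove e γ) z.2.1) z.2.2 ≤ (0 : ℝ))
    (hz' : z' ∈ cyl r z₀) (hx' : z'.2.1 ∈ Metric.ball z₀.2.1 R) (hfr' : z'.2.1 ∈ frontier Ω)
    (hin' : inner ℝ (gradient (heightAbove e γ) z'.2.1) z'.2.2 ≤ (0 : ℝ)) :
    |f z - f z'| ≤ (holderNorm β fb (cyl r z₀ ∩ incoming Ω)).toReal * phaseNorm (z - z') ^ β := by
  obtain ⟨u, hu, hu'⟩ := h.exists_incoming hz hx hfr hin
  obtain ⟨w, hw, hw'⟩ := h.exists_incoming hz' hx' hfr' hin'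
  have hsub : cyl r z₀ ∩ incoming Ω ⊆ domCyl Ω r z₀ := fun p hp =>
    ⟨hp.1, frontier_subset_closure hp.2.1⟩
  have l1 := (hf.continuousOn z ⟨hz, frontier_subset_closure hfr⟩).tendsto.comp
    (tendsto_nhdsWithin_iff.2 ⟨hu, hu'.mono fun s hs => hsub hs⟩)
  have l2 := (hf.continuousOn z' ⟨hz', frontier_subset_closure hfr'⟩).tendsto.comp
    (tendsto_nhdsWithin_iff.2 ⟨hw, hw'.mono fun s hs => hsub hs⟩)
  have l3 := (((continuous_phaseNorm.tendsto _).comp (hu.sub hw)).rpow_const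
    (Or.inr hβ.le)).const_mul (holderNorm β fb (cyl r z₀ ∩ incoming Ω)).toReal
  refine le_of_tendsto_of_tendsto (l1.sub l2).abs l3 ?_
  filter_upwards [hu', hw'] with s h1 h2
  simp only [Function.comp]
  rw [heq _ h1, heq _ h2]
  exact abs_sub_le_holderNorm hfb h1 h2

/-- By linearity the one-sided decay estimate applies to `-f` as well, which supplies the lower
bound. -/
lemma IsClassicalSolution.neg (hf : IsClassicalSolution Ω r z₀ A B S f) :
    IsClassicalSolution Ω r z₀ A B (fun z => -S z) (fun z => -f z) := by
  have hT : transportDeriv (fun z => -f z) = fun z => -transportDeriv f z := by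
    funext z
    exact deriv.fun_neg (f := alongTransport f z)
  have hslice : ∀ z, vSlice (fun z => -f z) z = fun w => -vSlice f z w := fun z => rfl
  have hfd : ∀ z, fderiv ℝ (vSlice (fun z => -f z) z) = fun w => -fderiv ℝ (vSlice f z) w := by
    intro z
    funext w
    rw [hslice, fderiv_fun_neg]
  have hH : vHess (fun z => -f z) = fun z => -vHess f z := by
    funext z i j
    simp only [vHess, Matrix.neg_apply]
    rw [hfd, fderiv_fun_neg]
    simp
  have hG : ∀ z, vGrad (fun z => -f z) z = -vGrad f z := by
    intro z
    rw [vGrad, gradient, hfd, map_neg]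
    rfl
  refine ⟨hf.continuousOn.neg, fun z hz => (hf.transport_differentiable z hz).neg, ?_,
    fun z hz => (hf.velocity_contDiffAt z hz).neg, ?_, fun z hz => ?_⟩
  · rw [hT]; exact hf.transport_continuousOn.neg
  · rw [hH]; exact hf.hess_continuousOn.neg
  · rw [hT, hH, hG]
    simp only [hf.equation z hz, Matrix.neg_apply, mul_neg, Finset.sum_neg_distrib, inner_neg_right]
    ring

lemma phaseNorm_sub_comm (z z' : Phase d) : phaseNorm (z - z') = phaseNorm (z' - z) := by
  simp only [phaseNorm, Prod.fst_sub, Prod.snd_sub]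
  rw [norm_sub_rev z.2.1, norm_sub_rev z.2.2]
  congr 3
  ring

lemma phaseNorm_sub_le_of_mem_cyl {ρ : ℝ} (hr : 0 < r) (hr1 : r ≤ 1) (hv : ‖z₀.2.2‖ ≤ ρ)
    {z : Phase d} (hz : z ∈ cyl r z₀) : phaseNorm (z - z₀) ≤ (ρ + 3) * r := by
  obtain ⟨h1, h2, h3, h4⟩ := hz
  have hρ : 0 ≤ ρ := (norm_nonneg _).trans hv
  have hr2 : r ^ 2 ≤ r := by nlinarith
  have ht : |z.1 - z₀.1| ≤ r ^ 2 := by rw [abs_le]; constructor <;> linarith [sq_nonneg r]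
  have hx := norm_sub_le_of_mem_cyl hr1 hr hv ht hr.le le_rfl h3.le
  have hx' : r ^ 2 * (ρ + 1) ≤ r * (ρ + 1) := by gcongr
  refine Real.sqrt_le_iff.2 ⟨by positivity, ?_⟩
  simp only [Prod.fst_sub, Prod.snd_sub]
  have e1 : (z.1 - z₀.1) ^ 2 = |z.1 - z₀.1| ^ 2 := (sq_abs _).symm
  have e2 : |z.1 - z₀.1| + ‖z.2.1 - z₀.2.1‖ + ‖z.2.2 - z₀.2.2‖ ≤ (ρ + 3) * r := by linarith
  rw [e1]
  have a1 := abs_nonneg (z.1 - z₀.1)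
  have a2 := norm_nonneg (z.2.1 - z₀.2.1)
  have a3 := norm_nonneg (z.2.2 - z₀.2.2)
  calc _ ≤ (|z.1 - z₀.1| + ‖z.2.1 - z₀.2.1‖ + ‖z.2.2 - z₀.2.2‖) ^ 2 := by
        nlinarith [mul_nonneg a1 a2, mul_nonneg a1 a3, mul_nonneg a2 a3]
    _ ≤ _ := by gcongr

lemma components_le_phaseNorm (z : Phase d) :
    |z.1| ≤ phaseNorm z ∧ ‖z.2.1‖ ≤ phaseNorm z ∧ ‖z.2.2‖ ≤ phaseNorm z := by
  have h1 := sq_nonneg z.1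
  have h2 := sq_nonneg ‖z.2.1‖
  have h3 := sq_nonneg ‖z.2.2‖
  refine ⟨Real.le_sqrt_of_sq_le ?_, Real.le_sqrt_of_sq_le ?_, Real.le_sqrt_of_sq_le ?_⟩
  · rw [sq_abs]; linarith
  · linarith
  · linarith

/-- A point at Euclidean distance `s ^ 3 ≤ 1` from `z₀` lies in a kinetic cylinder of radius
comparable to `s`. -/
lemma mem_cyl_of_phaseNorm_le {ρ s : ℝ} (hv : ‖z₀.2.2‖ ≤ ρ) (hs : 0 < s) (hs1 : s ≤ 1)
    (hr : (ρ + 2) * s ≤ r) {z : Phase d} (ht : z.1 ≤ z₀.1) (hz : phaseNorm (z - z₀) ≤ s ^ 3) :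
    z ∈ cyl r z₀ := by
  have hρ : 0 ≤ ρ := (norm_nonneg _).trans hv
  obtain ⟨h1, h2, h3⟩ := components_le_phaseNorm (z - z₀)
  simp only [Prod.fst_sub, Prod.snd_sub] at h1 h2 h3
  have hsr : 2 * s ≤ r := by nlinarith
  have hs2 : s ^ 3 ≤ s ^ 2 := pow_le_pow_of_le_one hs.le hs1 (by norm_num)
  have hs3 : s ^ 3 ≤ s := pow_le_of_le_one hs.le hs1 (by norm_num)
  have hr2 : (2 * s) ^ 2 ≤ r ^ 2 := by gcongr
  have hr3 : ((ρ + 2) * s) ^ 3 ≤ r ^ 3 := by gcongr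
  have hspos : 0 < s ^ 2 := by positivity
  refine ⟨?_, ht, ?_, by linarith⟩
  · have := (abs_le.1 h1).1
    nlinarith
  · have e1 := norm_sub_le (z.2.1 - z₀.2.1) ((z.1 - z₀.1) • z₀.2.2)
    rw [norm_smul, Real.norm_eq_abs] at e1
    have e2 : |z.1 - z₀.1| * ‖z₀.2.2‖ ≤ s ^ 3 * ρ := by
      gcongr; linarith
    have e3 : (ρ + 1) * s ^ 3 < ((ρ + 2) * s) ^ 3 := by
      rw [mul_pow]
      gcongr
      nlinarith [mul_nonneg hρ hρ, mul_nonneg hρ (mul_nonneg hρ hρ)]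
    linarith

end Data

/-! ### Geometric decay over all scales -/

section Iteration

variable {d : ℕ} {Ω : Set (Vec d)} {z₀ : Phase d} {r : ℝ}
  {A : Phase d → Matrix (Fin d) (Fin d) ℝ} {B : Phase d → Vec d} {S f : Phase d → ℝ}

/-- The factor by which the oscillation decays from one scale to the next. -/
def decayFactor (d : ℕ) (lam Lam L β : ℝ) : ℝ :=
  max (1 - barrierGain d lam Lam L / 2) (barrierRatio d Lam L ^ β)

/-- The constant in the decay of the oscillation. -/
def decayConst (d : ℕ) (lam Lam L ρ : ℝ) : ℝ :=
  2 * (ρ + 3 + Real.exp (barrierExponent d lam Lam L) / barrierExponent d lam Lam L) /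
    barrierGain d lam Lam L

lemma IsSmallRadius.mul {Lam R L ρ s : ℝ} {K : ℝ≥0} (h : IsSmallRadius d Lam R L ρ K r)
    (hLam : 0 < Lam) (hρ : 0 ≤ ρ) (hs : 0 < s) (hs1 : s ≤ 1) :
    IsSmallRadius d Lam R L ρ K (r * s) := by
  have hr := h.pos
  have hle : r * s ≤ r := mul_le_of_le_one_right hr.le hs1
  refine ⟨by positivity, hle.trans h.le_one, le_trans ?_ h.curvature, lt_of_le_of_lt ?_ h.chart,
    le_trans ?_ h.drift⟩ <;> gcongr

lemma exists_isSmallRadius (d : ℕ) {Lam R L ρ : ℝ} (K : ℝ≥0) (hLam : 0 < Lam) (hL : 0 ≤ L)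
    (hR : 0 < R) (hρ : 0 ≤ ρ) : ∃ r, IsSmallRadius d Lam R L ρ K r := by
  have hη := barrierRatio_pos d hLam hL
  set a := barrierRatio d Lam L ^ 3 / 16 with ha
  have hapos : 0 < a := by positivity
  set c₁ := (K : ℝ) * (ρ + 1) ^ 2 with hc₁
  set c₂ := Lam * (1 + (ρ + 1) ^ 2) + 1 with hc₂
  have h1 : 0 ≤ c₁ := by positivity
  have h2 : 0 < c₂ := by positivity
  set r := min (min 1 (a / (c₁ + 1))) (min (R / (2 * (ρ + 1))) (1 / c₂)) with hr
  have hpos : 0 < r := by positivity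
  have r1 : r ≤ 1 := (min_le_left _ _).trans (min_le_left _ _)
  have r2 : r ≤ a / (c₁ + 1) := (min_le_left _ _).trans (min_le_right _ _)
  have r3 : r ≤ R / (2 * (ρ + 1)) := (min_le_right _ _).trans (min_le_left _ _)
  have r4 : r ≤ 1 / c₂ := (min_le_right _ _).trans (min_le_right _ _)
  rw [le_div_iff₀ (by positivity)] at r2 r3 r4
  exact ⟨r, hpos, r1, by linarith, by nlinarith, by linarith⟩

/-- Geometric decay of the oscillation from above. -/
lemma IsAdaptedChart.decay_iterate {e : Vec d} {γ : Vec d → ℝ} {R L ρ lam Lam N β : ℝ} {K : ℝ≥0}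
    (hc : IsAdaptedChart Ω z₀ e γ R L ρ K) (hΩ : IsOpen Ω) (hΩb : Bornology.IsBounded Ω)
    (hs : IsSmallRadius d Lam R L ρ K r) (hlam : 0 < lam) (hLam : lam < Lam) (hL : 0 ≤ L)
    (hβ : β ∈ Ioo (0 : ℝ) 1)
    (hf : IsClassicalSolution Ω r z₀ A B S f)
    (hcoef : CoeffBounds lam Lam A B (domCylInterior Ω r z₀))
    (hS : ∀ᵐ z ∂volume, z ∈ domCylInterior Ω r z₀ → S z ≤ N)
    (hN : ∀ z ∈ domCyl Ω r z₀, |f z| ≤ N)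
    (hb : ∀ z ∈ domCyl Ω r z₀, z.2.1 ∈ frontier Ω →
      inner ℝ (gradient (heightAbove e γ) z.2.1) z.2.2 ≤ (0 : ℝ) →
      f z ≤ f z₀ + N * phaseNorm (z - z₀) ^ β) (n : ℕ) :
    ∀ z ∈ domCyl Ω (r * barrierRatio d Lam L ^ n) z₀,
      f z ≤ f z₀ + decayConst d lam Lam L ρ * N * decayFactor d lam Lam L β ^ n := by
  have hLpos := hlam.trans hLam
  have hρ : 0 ≤ ρ := (norm_nonneg _).trans hc.velocity_le
  have hr := hs.pos
  have hη := barrierRatio_pos d hLpos hL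
  have hη1 := barrierRatio_le d hLpos hL
  have hμ := barrierExponent_pos d hlam hLpos hL
  obtain ⟨hθ, hθ1⟩ := barrierGain_mem d hlam hLpos hL
  set C := Real.exp (barrierExponent d lam Lam L) / barrierExponent d lam Lam L with hC
  have hCpos : 0 < C := by positivity
  set Q := decayConst d lam Lam L ρ with hQ
  -- `Q` is tuned so that half of the gain `θ` absorbs the boundary error `ρ + 3` and the source
  -- error `C`; the other half gives the factor `1 - θ / 2`.
  have hQθ : Q * barrierGain d lam Lam L = 2 * (ρ + 3 + C) := by
    rw [hQ, decayConst, div_mul_cancel₀ _ hθ.ne']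
  set θ := barrierGain d lam Lam L with hθdef
  set η := barrierRatio d Lam L with hηdef
  set q := decayFactor d lam Lam L β with hq
  have hqθ : 1 - θ / 2 ≤ q := le_max_left _ _
  have hqη : η ^ β ≤ q := le_max_right _ _
  have hqpos : 0 < q := by linarith
  have hz₀ : z₀ ∈ domCyl Ω r z₀ := by
    refine ⟨⟨?_, le_rfl, ?_, ?_⟩, frontier_subset_closure hc.mem_frontier⟩
    · have : 0 < r ^ 2 := by positivity
      linarith
    · simp; positivity
    · simpa using hr
  have hN0 : 0 ≤ N := (abs_nonneg _).trans (hN z₀ hz₀)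
  have hQ2 : 2 ≤ Q := by
    have : Q * θ ≤ Q * 1 ∨ Q < 0 := by
      rcases le_or_gt 0 Q with h | h
      · exact Or.inl (by gcongr)
      · exact Or.inr h
    rcases this with h | h
    · linarith
    · nlinarith
  induction n with
  | zero =>
    intro z hz
    rw [pow_zero, mul_one] at hz
    have h1 := (abs_le.1 (hN z hz)).2
    have h2 := (abs_le.1 (hN z₀ hz₀)).1
    rw [pow_zero, mul_one]
    nlinarith
  | succ n ih =>
    intro z hz
    have hηn : 0 < η ^ n := by positivity
    have hηn1 : η ^ n ≤ 1 := pow_le_one₀ hη.le (by linarith)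
    have hsn := hs.mul (s := η ^ n) hLpos hρ hηn hηn1
    have hrn : r * η ^ n ≤ r := mul_le_of_le_one_right hr.le hηn1
    have hsub := domCylInterior_subset (Ω := Ω) (z₀ := z₀) hsn.pos.le hrn
    have hpow : η ^ n ≤ 1 := hηn1
    -- This is why `q` is at least `η ^ β`: the oscillation cannot be made to decay faster than the
    -- data.
    have hbn : ((ρ + 3) * (r * η ^ n)) ^ β ≤ (ρ + 3) * q ^ n := by
      rw [Real.mul_rpow (by positivity) (by positivity), Real.mul_rpow hr.le hηn.le]
      have e1 : (ρ + 3) ^ β ≤ ρ + 3 := by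
        calc (ρ + 3) ^ β ≤ (ρ + 3) ^ (1 : ℝ) :=
              Real.rpow_le_rpow_of_exponent_le (by linarith) hβ.2.le
          _ = ρ + 3 := Real.rpow_one _
      have e2 : r ^ β ≤ 1 := Real.rpow_le_one hr.le hs.le_one hβ.1.le
      have e3 : (η ^ n) ^ β ≤ q ^ n := by
        rw [← Real.rpow_natCast, ← Real.rpow_mul hη.le, mul_comm, Real.rpow_mul hη.le,
          Real.rpow_natCast]
        gcongr
      have e4 : 0 ≤ (η ^ n) ^ β := by positivity
      calc (ρ + 3) ^ β * (r ^ β * (η ^ n) ^ β) ≤ (ρ + 3) * (1 * q ^ n) := by gcongr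
        _ = _ := by ring
    have hrn2 : (r * η ^ n) ^ 2 ≤ q ^ n := by
      have e0 : η ≤ q := by
        refine le_trans ?_ hqη
        calc η = η ^ (1 : ℝ) := (Real.rpow_one _).symm
          _ ≤ η ^ β := Real.rpow_le_rpow_of_exponent_ge hη (by linarith) hβ.2.le
      have e1 : η ^ n ≤ q ^ n := by gcongr
      calc (r * η ^ n) ^ 2 = r ^ 2 * (η ^ n * η ^ n) := by ring
        _ ≤ 1 * (q ^ n * 1) := by
            gcongr
            exact pow_le_one₀ hr.le hs.le_one
        _ = q ^ n := by ring
    have step := hc.decay hΩ hΩb hsn hlam hLam hL (hf.mono hsn.pos.le hrn) (hcoef.mono hsub)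
      (hS.mono fun w hw h => hw (hsub h)) hN0
      (M := f z₀ + Q * N * q ^ n) (b := f z₀ + N * ((ρ + 3) * q ^ n)) ih
      (fun w hw h1 h2 => by
        refine (hb w (domCyl_subset_domCyl hsn.pos.le hrn hw) h1 h2).trans ?_
        gcongr
        refine le_trans ?_ hbn
        exact Real.rpow_le_rpow (Real.sqrt_nonneg _)
          (phaseNorm_sub_le_of_mem_cyl hsn.pos hsn.le_one hc.velocity_le hw.1) hβ.1.le)
      (z := z) (by rw [← hηdef, show η * (r * η ^ n) = r * η ^ (n + 1) by ring]; exact hz)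
    rw [← hθdef, ← hC] at step
    have hqn : 0 < q ^ n := by positivity
    have f1 : C * (N * (r * η ^ n) ^ 2) ≤ C * (N * q ^ n) := by gcongr
    have f2 : θ * (N * ((ρ + 3) * q ^ n)) ≤ 1 * (N * ((ρ + 3) * q ^ n)) := by gcongr
    have f3 : Q * N * (q ^ n * (1 - θ / 2)) ≤ Q * N * q ^ (n + 1) := by
      rw [pow_succ]
      gcongr
    have f4 : Q * N * (q ^ n * (1 - θ / 2)) = (1 - θ) * (Q * N * q ^ n) +
        (Q * θ) * (N * q ^ n) / 2 := by ring
    rw [hQθ] at f4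
    linarith

/-- Points of `Σ₀ ∪ Σ₋` have adapted charts with uniform constants. -/
lemma exists_adaptedChart (hΩ : IsOpen Ω) {R L ρ : ℝ} {K : ℝ≥0}
    (hR : ∀ x₀ ∈ frontier Ω, ∃ e γ, IsBoundaryGraph Ω x₀ R e γ ∧
      LipschitzWith K (gradient (heightAbove e γ)) ∧ ‖gradient (heightAbove e γ) x₀‖ ≤ L)
    (hz : z₀ ∈ grazing Ω ∪ incoming Ω) (hv : ‖z₀.2.2‖ ≤ ρ) :
    ∃ e γ, IsAdaptedChart Ω z₀ e γ R L ρ K := by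
  obtain ⟨hfr, n, ⟨r', e', γ', hgr, rfl⟩, hn⟩ : z₀.2.1 ∈ frontier Ω ∧
      ∃ n, IsOutwardNormal Ω z₀.2.1 n ∧ inner ℝ n z₀.2.2 ≤ (0 : ℝ) := by
    rcases hz with ⟨h1, n, h2, h3⟩ | ⟨h1, n, h2, h3⟩
    · exact ⟨h1, n, h2, h3.le⟩
    · exact ⟨h1, n, h2, h3.le⟩
  obtain ⟨e, γ, h1, h2, h3⟩ := hR _ hfr
  refine ⟨e, γ, h1, h2, h3, hfr, hgr.inner_gradient_nonpos h1 hΩ hfr ?_, hv⟩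
  rw [inner_smul_left] at hn
  have hg : 0 < ‖gradient (heightAbove e' γ') z₀.2.1‖ :=
    one_pos.trans_le (hgr.one_le_norm_gradient _)
  simp only [RCLike.conj_to_real] at hn
  by_contra! hpos
  have : 0 < ‖gradient (heightAbove e' γ') z₀.2.1‖⁻¹ *
      inner ℝ (gradient (heightAbove e' γ') z₀.2.1) z₀.2.2 := by positivity
  linarith

end Iteration

end KFP

end

/-! ### From geometric decay to the Hölder estimate -/

theorem theorem1p1 (d : ℕ) (Ω : Set (KFP.Vec d)) (hΩ_open : IsOpen Ω) (hΩ_conn : IsConnected Ω)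
    (hΩ_bdd : Bornology.IsBounded Ω) (hΩ_C11 : KFP.HasC11Boundary Ω)
    (αb lam Lam : ℝ) (hαb : αb ∈ Set.Ioo (0 : ℝ) 1) (hlam : 0 < lam) (hLam : lam < Lam) :
    ∃ α ∈ Set.Ioo (0 : ℝ) 1, ∃ C : ℝ → ℝ, (∀ ρ, 0 < C ρ) ∧
      ∀ z₀ ∈ KFP.grazing Ω ∪ KFP.incoming Ω,
      ∀ (A : KFP.Phase d → Matrix (Fin d) (Fin d) ℝ) (B : KFP.Phase d → KFP.Vec d)
        (S fb f : KFP.Phase d → ℝ),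
        KFP.CoeffBounds lam Lam A B (KFP.domCylInterior Ω 2 z₀) →
        MemLp S ∞ (volume.restrict (KFP.domCyl Ω 2 z₀)) →
        MemLp f ∞ (volume.restrict (KFP.domCyl Ω 2 z₀)) →
        KFP.holderNorm αb fb (KFP.cyl 2 z₀ ∩ KFP.incoming Ω) < ∞ →
        KFP.IsClassicalSolution Ω 2 z₀ A B S f →
        (∀ z ∈ KFP.cyl 2 z₀ ∩ KFP.incoming Ω, f z = fb z) →
        ∀ z ∈ KFP.domCyl Ω 1 z₀,
          |f z₀ - f z| ≤ C (KFP.phaseNorm z₀) * KFP.phaseNorm (z₀ - z) ^ α *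
            ((KFP.holderNorm αb fb (KFP.cyl 2 z₀ ∩ KFP.incoming Ω)).toReal +
              (KFP.supNorm f (KFP.domCyl Ω 2 z₀)).toReal +
              (KFP.supNorm S (KFP.domCyl Ω 2 z₀)).toReal) := by
  open KFP in
  obtain ⟨R, hR, L, hL, K, hchart⟩ := hΩ_C11.exists_uniform hΩ_bdd
  have hLpos := hlam.trans hLam
  have hη := barrierRatio_pos d hLpos hL
  have hη1 := barrierRatio_le d hLpos hL
  obtain ⟨hθ, hθ1⟩ := barrierGain_mem d hlam hLpos hL
  set η := barrierRatio d Lam L with hηdef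
  set q := decayFactor d lam Lam L αb with hq
  have hqθ : 1 - barrierGain d lam Lam L / 2 ≤ q := le_max_left _ _
  have hqη : η ^ αb ≤ q := le_max_right _ _
  have hqpos : 0 < q := by linarith
  have hq1 : q < 1 := max_lt (by linarith) (Real.rpow_lt_one hη.le (by linarith) hαb.1)
  have hlogη : Real.log η < 0 := Real.log_neg hη (by linarith)
  have hlogq : Real.log q < 0 := Real.log_neg hqpos hq1
  -- The exponent with `η ^ α₁ = q`. Neither `η` nor `q` involves the size of `z₀`, so only the
  -- constant will depend on it.
  set α₁ := Real.log q / Real.log η with hα₁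
  have hα₁pos : 0 < α₁ := div_pos_of_neg_of_neg hlogq hlogη
  have hηα : η ^ α₁ = q := by
    rw [Real.rpow_def_of_pos hη, hα₁, mul_div_cancel₀ _ hlogη.ne, Real.exp_log hqpos]
  have hα₁lt : α₁ < 1 := by
    have h1 : αb * Real.log η ≤ Real.log q := by
      rw [← Real.log_rpow hη]
      exact Real.log_le_log (by positivity) hqη
    have h2 : α₁ ≤ αb := by
      rw [hα₁, div_le_iff_of_neg hlogη]
      exact h1
    linarith [hαb.2]
  -- `α₁` is the exponent in the kinetic radius, which is the cube root of a Euclidean distance.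
  refine ⟨α₁ / 3, ⟨by positivity, by linarith⟩, ?_⟩
  suffices h : ∀ ρ : ℝ, ∃ C > 0, ∀ z₀ ∈ grazing Ω ∪ incoming Ω, phaseNorm z₀ = ρ →
      ∀ (A : Phase d → Matrix (Fin d) (Fin d) ℝ) (B : Phase d → Vec d) (S fb f : Phase d → ℝ),
        CoeffBounds lam Lam A B (domCylInterior Ω 2 z₀) →
        MemLp S ∞ (volume.restrict (domCyl Ω 2 z₀)) →
        MemLp f ∞ (volume.restrict (domCyl Ω 2 z₀)) →
        holderNorm αb fb (cyl 2 z₀ ∩ incoming Ω) < ∞ →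
        IsClassicalSolution Ω 2 z₀ A B S f →
        (∀ z ∈ cyl 2 z₀ ∩ incoming Ω, f z = fb z) →
        ∀ z ∈ domCyl Ω 1 z₀,
          |f z₀ - f z| ≤ C * phaseNorm (z₀ - z) ^ (α₁ / 3) *
            ((holderNorm αb fb (cyl 2 z₀ ∩ incoming Ω)).toReal +
              (supNorm f (domCyl Ω 2 z₀)).toReal + (supNorm S (domCyl Ω 2 z₀)).toReal) by
    choose C hC hmain using h
    exact ⟨C, hC, fun z₀ hz₀ => hmain _ z₀ hz₀ rfl⟩
  intro ρ'
  -- The absolute value makes the constant positive also for negative arguments, which no `z₀`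
  -- attains.
  obtain ⟨ρ, hρdef⟩ : ∃ ρ, ρ = |ρ'| := ⟨_, rfl⟩
  have hρ : 0 ≤ ρ := hρdef ▸ abs_nonneg _
  obtain ⟨r, hr⟩ := exists_isSmallRadius d K hLpos hL hR hρ
  have hrpos := hr.pos
  have hμ := barrierExponent_pos d hlam hLpos hL
  set Q := decayConst d lam Lam L ρ with hQ
  have hQ2 : 2 ≤ Q := by
    rw [hQ, decayConst, le_div_iff₀ hθ]
    have : 0 < Real.exp (barrierExponent d lam Lam L) / barrierExponent d lam Lam L := by positivity
    linarith
  refine ⟨Q / q * ((ρ + 2) / r) ^ α₁, by positivity, ?_⟩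
  intro z₀ hz₀ hzρ A B S fb f hcoef hS hfM hfb hf heq z hz
  set H := (holderNorm αb fb (cyl 2 z₀ ∩ incoming Ω)).toReal with hH
  set Nf := (supNorm f (domCyl Ω 2 z₀)).toReal with hNf
  set NS := (supNorm S (domCyl Ω 2 z₀)).toReal with hNS
  have hH0 : 0 ≤ H := ENNReal.toReal_nonneg
  have hNf0 : 0 ≤ Nf := ENNReal.toReal_nonneg
  have hNS0 : 0 ≤ NS := ENNReal.toReal_nonneg
  set N := H + Nf + NS with hN
  have hN0 : 0 ≤ N := by positivity
  have hv : ‖z₀.2.2‖ ≤ ρ := by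
    have := (components_le_phaseNorm z₀).2.2
    rw [hzρ] at this
    rw [hρdef]
    exact this.trans (le_abs_self _)
  obtain ⟨e, γ, hc⟩ := exists_adaptedChart hΩ_open hchart hz₀ hv
  have hr2 : r ≤ 2 := by linarith [hr.le_one]
  have hfbd : ∀ w ∈ domCyl Ω 2 z₀, |f w| ≤ Nf := fun w hw => hf.abs_le_supNorm hΩ_open hfM hw
  have hz₀2 : z₀ ∈ cyl 2 z₀ := ⟨by linarith, le_rfl, by simp, by simp⟩
  have hbd : ∀ w ∈ domCyl Ω r z₀, w.2.1 ∈ frontier Ω →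
      inner ℝ (gradient (heightAbove e γ) w.2.1) w.2.2 ≤ (0 : ℝ) →
      |f w - f z₀| ≤ N * phaseNorm (w - z₀) ^ αb := by
    intro w hw h1 h2
    have hball := (hc.dist_lt hr hw.1.1.le hw.1.2.1 hw.1.2.2.1.le).2
    refine (hf.abs_sub_le_of_boundary hc.graph hαb.1 hfb heq (cyl_subset_cyl hrpos.le hr2 hw.1)
      hball h1 h2 hz₀2 (Metric.mem_ball_self hR) hc.mem_frontier hc.inner_nonpos).trans ?_
    have : 0 ≤ phaseNorm (w - z₀) ^ αb := Real.rpow_nonneg (Real.sqrt_nonneg _) _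
    gcongr
    linarith
  have hsubI := domCylInterior_subset (Ω := Ω) (z₀ := z₀) hrpos.le hr2
  have hsubD := domCyl_subset_domCyl (Ω := Ω) (z₀ := z₀) hrpos.le hr2
  have hSae : ∀ᵐ w ∂volume, w ∈ domCylInterior Ω r z₀ → |S w| ≤ N := by
    filter_upwards [ae_abs_le_supNorm hS] with w hw hwi
    have := hw ⟨(hsubI hwi).1, subset_closure hwi.2.2⟩
    linarith
  have hNr : ∀ w ∈ domCyl Ω r z₀, |f w| ≤ N := fun w hw => by
    have := hfbd w (hsubD hw); linarith
  have up := hc.decay_iterate hΩ_open hΩ_bdd hr hlam hLam hL hαb (hf.mono hrpos.le hr2)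
    (hcoef.mono hsubI) (hSae.mono fun w hw h => (le_abs_self _).trans (hw h)) hNr
    (fun w hw h1 h2 => by have := (abs_le.1 (hbd w hw h1 h2)).2; linarith)
  have down := hc.decay_iterate hΩ_open hΩ_bdd hr hlam hLam hL hαb (hf.mono hrpos.le hr2).neg
    (hcoef.mono hsubI) (hSae.mono fun w hw h => (neg_le_abs _).trans (hw h))
    (fun w hw => by rw [abs_neg]; exact hNr w hw)
    (fun w hw h1 h2 => by have := (abs_le.1 (hbd w hw h1 h2)).1; linarith)
  set D := phaseNorm (z₀ - z) with hD
  have hD0 : 0 ≤ D := Real.sqrt_nonneg _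
  rcases hD0.eq_or_lt with hDz | hDpos
  · obtain ⟨h1, h2, h3⟩ := components_le_phaseNorm (z₀ - z)
    rw [← hD, ← hDz] at h1 h2 h3
    have : z₀ - z = 0 := Prod.ext (abs_nonpos_iff.1 h1)
      (Prod.ext (norm_le_zero_iff.1 h2) (norm_le_zero_iff.1 h3))
    rw [sub_eq_zero.1 this, sub_self, abs_zero]
    have : 0 ≤ D ^ (α₁ / 3) := Real.rpow_nonneg hD0 _
    positivity
  obtain ⟨s, hs, hsD⟩ : ∃ s > 0, s ^ 3 = D :=
    ⟨D ^ ((1 : ℝ) / 3), by positivity, by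
      rw [← Real.rpow_natCast, ← Real.rpow_mul hD0]; norm_num⟩
  have hDα : D ^ (α₁ / 3) = s ^ α₁ := by
    rw [← hsD, ← Real.rpow_natCast, ← Real.rpow_mul hs.le]
    congr 1
    push_cast
    ring
  have hgoal : Q / q * ((ρ + 2) / r) ^ α₁ * D ^ (α₁ / 3) * N =
      Q / q * ((ρ + 2) * s / r) ^ α₁ * N := by
    rw [hDα, mul_assoc (Q / q), ← Real.mul_rpow (by positivity) hs.le]
    congr 3
    ring
  rw [hgoal]
  have hxpos : 0 < (ρ + 2) * s / r := by positivity
  -- Near points are placed between two consecutive scales, and passing from `n + 1` to `n` costs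
  -- the factor `1 / q`. For far points the bound `2 * N` is enough.
  rcases le_or_gt ((ρ + 2) * s / r) 1 with hx | hx
  · obtain ⟨n, hn1, hn2⟩ := exists_nat_pow_near_of_lt_one hxpos hx hη (by linarith : η < 1)
    have hs1 : s ≤ 1 := by
      rw [div_le_one hrpos] at hx
      nlinarith [hr.le_one]
    have hzn : z ∈ domCyl Ω (r * η ^ n) z₀ := by
      refine ⟨mem_cyl_of_phaseNorm_le hv hs hs1 ?_ hz.1.2.1 ?_, hz.2⟩
      · rw [div_le_iff₀ hrpos] at hn2; linarith
      · rw [phaseNorm_sub_comm, hsD]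
    have h1 := up n z hzn
    have h2 := down n z hzn
    have h3 : |f z₀ - f z| ≤ Q * N * q ^ n := by
      rw [abs_le]
      constructor <;> linarith
    refine h3.trans ?_
    have h4 : q ^ (n + 1) ≤ ((ρ + 2) * s / r) ^ α₁ := by
      have e1 : q ^ (n + 1) = (η ^ (n + 1)) ^ α₁ := by
        rw [← hηα, ← Real.rpow_natCast, ← Real.rpow_natCast, ← Real.rpow_mul hη.le,
          ← Real.rpow_mul hη.le, mul_comm]
      rw [e1]
      exact Real.rpow_le_rpow (by positivity) hn1.le hα₁pos.le
    calc Q * N * q ^ n = Q / q * q ^ (n + 1) * N := by rw [pow_succ]; field_simp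
      _ ≤ _ := by gcongr
  · have h1 := hfbd z₀ ⟨hz₀2, frontier_subset_closure hc.mem_frontier⟩
    have h2 := hfbd z (domCyl_subset_domCyl (by norm_num) (by norm_num) hz)
    have h3 : |f z₀ - f z| ≤ 2 * N := (abs_sub _ _).trans (by linarith)
    have h4 : 1 ≤ ((ρ + 2) * s / r) ^ α₁ := Real.one_le_rpow hx.le hα₁pos.le
    have h5 : 2 ≤ Q / q := by rw [le_div_iff₀ hqpos]; linarith
    refine h3.trans ?_
    calc 2 * N = 2 * 1 * N := by ring
      _ ≤ _ := by gcongr
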